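/- Let $H$ be a finite group acting by automorphisms on a finite abelian group $A$ (written additively), with semidirect product $H\ltimes A$, $(h,a)(h',a')=(hh',a+ha')$. Let $H$ act transitively on a set $Y$, and let $(B_y)_{y\in Y}$ be abelian groups with group isomorphisms $h\colon B_y\to B_{hy}$ ($h\in H$) satisfying $(hh')b=h(h'b)$ and $1_Hb=b$, and surjective homomorphisms $\pi_y\colon A\to B_y$ with $h\pi_y(a)=\pi_{hy}(ha)$. Then $H\ltimes A$ acts on $X=\{(y,b)\colon y\in Y,\ b\in B_y\}$ by $(h,a)(y,b)=(hy,\pi_{hy}(a)+hb)$. Fix $y_0\in Y$; let $K$ be its stabilizer in $H$, $\pi=\pi_{y_0}$, $C=\ker\pi$ and $B=B_{y_0}$, so that $X$ is the homogeneous space $(H\ltimes A)/(K\ltimes C)$. For a finite set $Z$ with an action of a group, $L(Z)$ is the permutation representation on the complex functions on $Z$. It is multiplicity-free if it is a direct sum of pairwise inequivalent irreducible subrepresentations, and $(G,M)$ is a Gelfand pair if $L(G/M)$ is multiplicity-free. For a character $\theta\in\widehat B$ let $\overset{\triangle}{\theta}=\theta\circ\pi\in\widehat A$ be its inflation, let $H_\theta=\{h\in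 H\colon {}^h\overset{\triangle}{\theta}=\overset{\triangle}{\theta}\}$, where ${}^h\psi(a)=\psi(h^{-1}a)$, and let $K_\theta=H_\theta\cap K$. Let $\Theta$ be a complete set of representatives for the orbits of $K$ on $\widehat B$, where ${}^k\theta(b)=\theta(k^{-1}b)$, and let $\Xi\subseteq\Theta$ be such that $\{\overset{\triangle}{\xi}\colon\xi\in\Xi\}$ is a complete set of representatives for the $H$-orbits in $\widehat A$ that contain characters inflated from $B$. For each $\theta\in\Theta$ let $L(H_\theta/K_\theta)\sim\bigoplus_j m_{\theta,j}\sigma_{\theta,j}$, with $m_{\theta,j}\ge 1$ and with $\sigma_{\theta,j}$ irreducible and pairwise inequivalent for fixed $\theta$, be a decomposition into irreducible representations of $H_\theta$. Denote by $\widetilde{\overline\theta}\otimes\overset{\triangle}{\sigma_{\theta,j}}$ the representation $(h,a)\mapsto\overline{\theta(\pi(a))}\,\sigma_{\theta,j}(h)$ of $H_\theta\ltimes A$. Then the representation of $H\ltimes A$ on $L(X)$ is multiplicity-free, equivalently $(H\ltimes A,K\ltimes C)$ is a Gelfand pair, if and only if both of the following hold: (i) $\Xi=\Theta$; equivalently,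 any two characters of $B$ whose inflations lie in the same $H$-orbit in $\widehat A$ lie in the same $K$-orbit in $\widehat B$; (ii) for every $\theta\in\Theta$, $(H_\theta,K_\theta)$ is a Gelfand pair, that is, $L(H_\theta/K_\theta)$ is multiplicity-free. Moreover, in this case $$L(X)\sim\bigoplus_{\theta\in\Theta}\bigoplus_{j}\mathrm{Ind}_{H_\theta\ltimes A}^{H\ltimes A}\left(\widetilde{\overline{\theta}}\otimes\overset{\triangle}{\sigma_{\theta,j}}\right),$$ where the summands are irreducible and, for different pairs $(\theta,j)$, pairwise inequivalent. Finally, $$\dim\mathrm{Ind}_{H_\theta\ltimes A}^{H\ltimes A}\left(\widetilde{\overline{\theta}}\otimes\overset{\triangle}{\sigma_{\theta,j}}\right)=\frac{|H|\dim\sigma_{\theta,j}}{|H_\theta|}\qquad\text{for all }\theta\in\Theta\text{ and all }j.$$ -/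

import Mathlib

open scoped DirectSum

noncomputable section

/-! ### Representations of finite groups -/

section Representations

/-- The permutation representation of `G` on `L(X)`, the complex functions on `X`:
`[g f](x) = f (g⁻¹ x)`. -/
def permRep (G : Type*) [Group G] (X : Type*) [MulAction G X] :
    Representation ℂ G (X → ℂ) where
  toFun g := LinearMap.funLeft ℂ ℂ (fun x : X => g⁻¹ • x)
  map_one' := by
    ext f x
    simp [LinearMap.funLeft_apply]
  map_mul' g g' := by
    ext f x
    simp [LinearMap.funLeft_apply, mul_smul]

/-- A representation is multiplicity-free if it is the (internal, finite) direct sum of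
pairwise inequivalent irreducible subrepresentations. -/
def IsMultiplicityFree {G V : Type*} [Group G] [AddCommGroup V] [Module ℂ V]
    (ρ : Representation ℂ G V) : Prop :=
  ∃ (n : ℕ) (W : Fin n → Subrepresentation ρ),
    DirectSum.IsInternal (fun i => (W i).toSubmodule) ∧
    (∀ i, (W i).toRepresentation.IsIrreducible) ∧
    ∀ i j, i ≠ j → IsEmpty ((W i).toRepresentation.Equiv (W j).toRepresentation)

/-- `(G, K)` is a Gelfand pair if the permutation representation of `G` on `L(G/K)` is
multiplicity-free. -/
def IsGelfandPair (G : Type*) [Group G] (K : Subgroup G) : Prop :=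
  IsMultiplicityFree (permRep G (G ⧸ K))

/-- `ρ ∼ ⨁ⱼ m j • σ j` is a decomposition into irreducible representations: the `σ j` are
irreducible and pairwise inequivalent and `m j ≥ 1` is the multiplicity of `σ j` in `ρ`. -/
structure IsIrreducibleDecomposition {G V J : Type*} [Group G] [AddCommGroup V] [Module ℂ V]
    {U : J → Type*} [∀ j, AddCommGroup (U j)] [∀ j, Module ℂ (U j)]
    (ρ : Representation ℂ G V) (σ : ∀ j, Representation ℂ G (U j)) (m : J → ℕ) : Prop where
  irreducible : ∀ j, (σ j).IsIrreducible
  inequivalent : ∀ i j, i ≠ j → IsEmpty ((σ i).Equiv (σ j))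
  pos : ∀ j, 0 < m j
  equiv : Nonempty (ρ.Equiv
    (Representation.directSum (fun x : (Σ j, Fin (m j)) => σ x.1)))

variable {G V : Type*} [Group G] [AddCommGroup V] [Module ℂ V]

/-- The space of the induced representation from a subgroup `K` of `G`:
all `f : G → V` such that `f (g k) = σ (k⁻¹) (f g)` for all `g ∈ G`, `k ∈ K`. -/
def indSpace {K : Subgroup G} (σ : Representation ℂ K V) : Submodule ℂ (G → V) where
  carrier := {f | ∀ (g : G) (k : K), f (g * k) = σ k⁻¹ (f g)}
  add_mem' {f f'} hf hf' g k := by simp [hf g k, hf' g k]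
  zero_mem' g k := by simp
  smul_mem' c f hf g k := by simp [hf g k]

/-- The induced representation `Ind_K^G σ`, acting by `[g f](x) = f (g⁻¹ x)`. -/
def indRep {K : Subgroup G} (σ : Representation ℂ K V) :
    Representation ℂ G (indSpace σ) where
  toFun g := ((LinearMap.funLeft ℂ V (fun x : G => g⁻¹ * x))).restrict (by
    intro f hf x k
    simpa [LinearMap.funLeft_apply, mul_assoc] using hf (g⁻¹ * x) k)
  map_one' := by
    ext f x
    simp [LinearMap.funLeft_apply]
  map_mul' g g' := by
    ext f x
    show f.1 ((g * g')⁻¹ * x) = f.1 (g'⁻¹ * (g⁻¹ * x))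
    rw [mul_inv_rev, mul_assoc]

end Representations

/-! ### The semidirect product -/

section Semidirect

variable (H A : Type*) [Group H] [AddCommGroup A] [DistribMulAction H A]

/-- The action of `H` on `A` as a homomorphism into the automorphism group of `A`
(written multiplicatively). -/
def actionHom : H →* MulAut (Multiplicative A) where
  toFun h := AddEquiv.toMultiplicative (DistribMulAction.toAddEquiv A h)
  map_one' := by
    ext a
    exact congrArg Multiplicative.ofAdd (one_smul H (Multiplicative.toAdd a))
  map_mul' h h' := by
    ext a
    exact congrArg Multiplicative.ofAdd (mul_smul h h' (Multiplicative.toAdd a))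

/-- The semidirect product `H ⋉ A`, with product `(h, a) (h', a') = (h h', a + h a')`.
For `g = (h, a)` one has `h = g.right` and `a = g.left.toAdd`. -/
abbrev SemiProd : Type _ := Multiplicative A ⋊[actionHom H A] H

variable {H A}

/-- The subgroup `S ⋉ A` of `H ⋉ A`, for a subgroup `S` of `H`. -/
def overA (S : Subgroup H) : Subgroup (SemiProd H A) :=
  S.comap SemidirectProduct.rightHom

/-- The subgroup `K ⋉ C` of `H ⋉ A`, for `K ≤ H` and a `K`-invariant subgroup `C ≤ A`. -/
def subSemiProd (K : Subgroup H) (C : AddSubgroup A)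
    (hC : ∀ k ∈ K, ∀ c ∈ C, k • c ∈ C) : Subgroup (SemiProd H A) where
  carrier := {g | g.right ∈ K ∧ g.left.toAdd ∈ C}
  one_mem' := ⟨K.one_mem, C.zero_mem⟩
  mul_mem' hg hg' :=
    ⟨K.mul_mem hg.1 hg'.1, C.add_mem hg.2 (hC _ hg.1 _ hg'.2)⟩
  inv_mem' hg :=
    ⟨K.inv_mem hg.1, hC _ (K.inv_mem hg.1) _ (C.neg_mem hg.2)⟩

/-- The `h`-translate of a character of `A`: `(ʰψ)(a) = ψ(h⁻¹ a)`. -/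
def charTranslate (h : H) (ψ : AddChar A Circle) : AddChar A Circle :=
  ψ.compAddMonoidHom (DistribSMul.toAddMonoidHom A h⁻¹)

/-- The stabilizer in `H` of a character of `A`. -/
def charStabilizer (ψ : AddChar A Circle) : Subgroup H where
  carrier := {h | charTranslate h ψ = ψ}
  one_mem' := by
    ext a
    simp [charTranslate]
  mul_mem' {h h'} hh hh' := by
    ext a
    have h1 := DFunLike.congr_fun (show charTranslate h ψ = ψ from hh) a
    have h2 := DFunLike.congr_fun (show charTranslate h' ψ = ψ from hh') (h⁻¹ • a)
    simp only [charTranslate, AddChar.compAddMonoidHom_apply,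
      DistribSMul.toAddMonoidHom_apply] at h1 h2 ⊢
    rw [mul_inv_rev, mul_smul, h2, h1]
  inv_mem' {h} hh := by
    ext a
    have h1 := DFunLike.congr_fun (show charTranslate h ψ = ψ from hh) (h • a)
    simp only [charTranslate, AddChar.compAddMonoidHom_apply,
      DistribSMul.toAddMonoidHom_apply, inv_smul_smul, inv_inv] at h1 ⊢
    rw [h1]

/-- The representation `ψ̃ ⊗ σ△` of `T ⋉ A`, given by `(h, a) ↦ ψ(a) σ(h)`, where `T` is a
subgroup of `H` fixing the character `ψ` of `A` and `σ` is a representation of `T`.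
Here `ψ̃(h, a) = ψ(a)` is the extension of `ψ` and `σ△(h, a) = σ(h)` the inflation of `σ`. -/
def extTensorInfl (T : Subgroup H) (ψ : AddChar A Circle)
    (hψ : ∀ h ∈ T, charTranslate h ψ = ψ) {U : Type*} [AddCommGroup U] [Module ℂ U]
    (σ : Representation ℂ T U) : Representation ℂ (overA (A := A) T) U where
  toFun g := (ψ g.1.left.toAdd : ℂ) • σ ⟨g.1.right, g.2⟩
  map_one' := by
    have h1 : ψ (Multiplicative.toAdd ((1 : overA (A := A) T) : SemiProd H A).left) = 1 :=
      ψ.map_zero_eq_one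
    have h2 : (⟨((1 : overA (A := A) T) : SemiProd H A).right,
        (1 : overA (A := A) T).2⟩ : T) = 1 := rfl
    rw [h1, h2]
    simp
  map_mul' g g' := by
    have hs : ∀ a : A, ψ (g.1.right • a) = ψ a := by
      intro a
      have h1 := DFunLike.congr_fun (hψ g.1.right g.2) (g.1.right • a)
      simpa [charTranslate] using h1.symm
    have h1 : ψ (g * g').1.left.toAdd = ψ g.1.left.toAdd * ψ g'.1.left.toAdd := by
      rw [← hs g'.1.left.toAdd, ← AddChar.map_add_eq_mul]
      rfl
    have h2 : (⟨(g * g').1.right, (g * g').2⟩ : T) =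
        ⟨g.1.right, g.2⟩ * ⟨g'.1.right, g'.2⟩ := rfl
    rw [h1, h2, map_mul]
    ext u
    simp only [Circle.coe_mul, LinearMap.smul_apply, Module.End.mul_apply, map_smul, mul_smul]
    exact smul_comm _ _ _

end Semidirect

/-! ### The homogeneous space -/

/-- The data of the construction: an action of `H` by group isomorphisms `b ↦ h b`,
`B y → B (h y)`, on the family `(B y)`, and surjective homomorphisms `π y : A → B y`
with `h (π y a) = π (h y) (h a)`.
The isomorphism `h : B y → B (h y)` is `act h rfl`; the extra argument `h • y = z` only serves
to write its target as `B z`, so that `(h h') b = h (h' b)` can be stated without casts. -/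
structure SemidirectSystem (H A Y : Type*) (B : Y → Type*) [Group H] [AddCommGroup A]
    [DistribMulAction H A] [MulAction H Y] [∀ y, AddCommGroup (B y)] where
  act : ∀ (h : H) {y z : Y}, h • y = z → (B y ≃+ B z)
  act_one : ∀ (y : Y) (b : B y), act 1 (one_smul H y) b = b
  act_mul : ∀ (h h' : H) {x y z : Y} (e' : h' • x = y) (e : h • y = z) (b : B x),
    act (h * h') (by rw [mul_smul, e', e]) b = act h e (act h' e' b)
  π : ∀ y, A →+ B y
  π_surjective : ∀ y, Function.Surjective (π y)
  act_π : ∀ (h : H) (y : Y) (a : A), act h rfl (π y a) = π (h • y) (h • a)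

namespace SemidirectSystem

variable {H A Y : Type*} {B : Y → Type*} [Group H] [AddCommGroup A]
  [DistribMulAction H A] [MulAction H Y] [∀ y, AddCommGroup (B y)]

/-- The space `X` of all pairs `(y, b)` with `y ∈ Y` and `b ∈ B y`. -/
def Space (_S : SemidirectSystem H A Y B) : Type _ := Σ y, B y

lemma act_π' (S : SemidirectSystem H A Y B) (h : H) {y z : Y} (e : h • y = z) (a : A) :
    S.act h e (S.π y a) = S.π z (h • a) := by
  subst e
  exact S.act_π h y a

/-- The action `(h, a) (y, b) = (h y, π_{h y}(a) + h b)` of `H ⋉ A` on `X`. -/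
instance instMulActionSpace (S : SemidirectSystem H A Y B) :
    MulAction (SemiProd H A) S.Space where
  smul g x := ⟨g.right • x.1, S.π (g.right • x.1) g.left.toAdd + S.act g.right rfl x.2⟩
  one_smul x := by
    obtain ⟨y, b⟩ := x
    have key : ∀ (z : Y) (e : (1 : H) • y = z) (_ : z = y),
        (⟨z, S.π z 0 + S.act 1 e b⟩ : Σ y, B y) = ⟨y, b⟩ := by
      intro z e e'
      subst e'
      rw [S.act_one z b, map_zero, zero_add]
    exact key _ rfl (one_smul H y)
  mul_smul g g' x := by
    obtain ⟨y, b⟩ := x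
    have key : ∀ (z : Y) (e : (g.right * g'.right) • y = z)
        (e' : g.right • g'.right • y = z),
        (⟨z, S.π z (g.left.toAdd + g.right • g'.left.toAdd)
          + S.act (g.right * g'.right) e b⟩ : Σ y, B y) =
        ⟨g.right • g'.right • y, S.π (g.right • g'.right • y) g.left.toAdd +
          S.act g.right rfl (S.π (g'.right • y) g'.left.toAdd + S.act g'.right rfl b)⟩ := by
      intro z e e'
      subst e'
      rw [map_add, map_add, S.act_π, S.act_mul g.right g'.right rfl rfl b, add_assoc]
    exact key _ rfl (mul_smul _ _ _).symm

variable (S : SemidirectSystem H A Y B) (y₀ : Y)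

/-- `C = Ker π_{y₀}`. -/
def C : AddSubgroup A := (S.π y₀).ker

/-- `C` is invariant under the stabilizer `K` of `y₀`. -/
lemma smul_mem_C : ∀ k ∈ MulAction.stabilizer H y₀, ∀ c ∈ S.C y₀, k • c ∈ S.C y₀ := by
  intro k hk c hc
  have hk' : k • y₀ = y₀ := hk
  have hc' : S.π y₀ c = 0 := hc
  show S.π y₀ (k • c) = 0
  rw [← S.act_π' k hk', hc', map_zero]

/-- The subgroup `K ⋉ C` of `H ⋉ A`, where `K` is the stabilizer of `y₀` and `C = Ker π_{y₀}`. -/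
def KC : Subgroup (SemiProd H A) :=
  subSemiProd (MulAction.stabilizer H y₀) (S.C y₀) (S.smul_mem_C y₀)

/-- The inflation to `A` of a character `θ` of `B = B_{y₀}`: `a ↦ θ(π_{y₀}(a))`. -/
def infl (θ : AddChar (B y₀) Circle) : AddChar A Circle := θ.compAddMonoidHom (S.π y₀)

/-- The translate `(ᵏθ)(b) = θ(k⁻¹ b)` of a character `θ` of `B = B_{y₀}` by an element `k`
of the stabilizer `K` of `y₀`. -/
def baseTranslate (k : MulAction.stabilizer H y₀) (θ : AddChar (B y₀) Circle) :
    AddChar (B y₀) Circle :=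
  θ.compAddMonoidHom
    (S.act (k⁻¹ : MulAction.stabilizer H y₀).1 (k⁻¹).2 : B y₀ ≃+ B y₀).toAddMonoidHom

/-- `Θ` is a complete set of representatives for the `K`-orbits of characters of `B_{y₀}`. -/
def IsKRepresentatives (Θ : Set (AddChar (B y₀) Circle)) : Prop :=
  ∀ χ : AddChar (B y₀) Circle, ∃! θ, θ ∈ Θ ∧ ∃ k, S.baseTranslate y₀ k θ = χ

/-- The inflations of the elements of `Ξ` form a complete set of representatives for the
`H`-orbits on the characters of `A` that contain a character inflated from `B_{y₀}`. -/
def IsHRepresentatives (Ξ : Set (AddChar (B y₀) Circle)) : Prop :=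
  ∀ ψ : AddChar A Circle, (∃ (h : H) (χ : AddChar (B y₀) Circle),
      charTranslate h ψ = S.infl y₀ χ) →
    ∃! φ, φ ∈ S.infl y₀ '' Ξ ∧ ∃ h : H, charTranslate h φ = ψ

/-- `H_θ`, the stabilizer in `H` of the inflation of `θ` to `A`. -/
def Hst (θ : AddChar (B y₀) Circle) : Subgroup H := charStabilizer (S.infl y₀ θ)

/-- `K_θ = H_θ ∩ K`, as a subgroup of `H_θ`. -/
def Kst (θ : AddChar (B y₀) Circle) : Subgroup (S.Hst y₀ θ) :=
  (S.Hst y₀ θ ⊓ MulAction.stabilizer H y₀).subgroupOf (S.Hst y₀ θ)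

/-- `H_θ` also fixes the inflation of the conjugate character `θ̄ = θ⁻¹`. -/
lemma charTranslate_infl_inv (θ : AddChar (B y₀) Circle) :
    ∀ h ∈ S.Hst y₀ θ, charTranslate h (S.infl y₀ θ⁻¹) = S.infl y₀ θ⁻¹ := by
  intro h hh
  ext a
  have h1 := DFunLike.congr_fun
    (show charTranslate h (S.infl y₀ θ) = S.infl y₀ θ from hh) (-a)
  simp only [charTranslate, infl, AddChar.compAddMonoidHom_apply, AddChar.inv_apply,
    DistribSMul.toAddMonoidHom_apply, map_neg] at h1 ⊢
  rw [h1]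

/-- The representation of `H ⋉ A` induced from the representation `θ̄~ ⊗ σ△` of `H_θ ⋉ A`,
where `θ̄ = θ⁻¹` is the conjugate character and `σ` is a representation of `H_θ`. -/
def wignerRep (θ : AddChar (B y₀) Circle) {U : Type*} [AddCommGroup U] [Module ℂ U]
    (σ : Representation ℂ (S.Hst y₀ θ) U) :
    Representation ℂ (SemiProd H A) (indSpace (extTensorInfl (S.Hst y₀ θ)
      (S.infl y₀ θ⁻¹) (S.charTranslate_infl_inv y₀ θ) σ)) :=
  indRep (extTensorInfl (S.Hst y₀ θ) (S.infl y₀ θ⁻¹) (S.charTranslate_infl_inv y₀ θ) σ)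

end SemidirectSystem

end

/-!
A representation `V` of `H ⋉ A` is the direct sum of its weight spaces `V_ψ` under `A`, which `H`
permutes along its action on the characters `ψ` of `A`, and `V_ψ` is a representation of the
stabilizer `H_ψ`. An endomorphism of `V` is determined by its restrictions to the `V_ψ` with `ψ` in
a set that meets every `H`-orbit of weights, and every `H_ψ`-endomorphism of a single `V_ψ` extends
to `V` by averaging over `H`. Since a representation is multiplicity-free if and only if its
commutant is commutative (`isMultiplicityFree_iff_hasCommutingEnd`, by the theorems of Schur and
Maschke), `V` is multiplicity-free if and only if the `V_ψ` are
(`HasCommutingEnd.on_weightSpace`, `hasCommutingEnd_of_weightRep`).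

The weights of `L(X)` are the `H`-translates of the inflations of the conjugates of the characters
`θ` in `Θ`, and a vector of such a weight is determined by its values at the points `(y, 0)`,
where `y` runs through the set `Y_θ` of those `y` for which the inflation of `θ` is trivial on the
kernel of `π y`. So this weight space is the permutation representation of `H_θ` on
`Y_θ` (`weightRepEquiv`). A permutation representation with commutative commutant is that of a
transitive action (`isPretransitive_of_hasCommutingEnd`), the stabilizer of `y₀` in `H_θ` is `K_θ`,
and all the `H_θ` are transitive on the `Y_θ` exactly if `H`-conjugate inflations come from
`K`-conjugate characters of `B`, that is, if `Ξ = Θ`. This gives the criterion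
(`hasCommutingEnd_iff`).

The decomposition is the method of little groups. In a representation of `H ⋉ A` induced from
`ψ̃ ⊗ σ△`, the functions supported on `H_ψ ⋉ A` are the vectors of weight `ψ`; they form a copy of
`σ` and generate. Hence the induced representation is irreducible if `σ` is
(`isIrreducible_indRep`), it determines `σ` and the orbit of `ψ`, and a map from `σ` to the vectors
of weight `ψ` of a representation extends to it (`exists_indRep_map`). The sum of these maps into
`L(X)` is injective, as the summands are irreducible and pairwise inequivalent, and surjective, as
its image contains the weight spaces that generate `L(X)`.
-/

open scoped DirectSum

noncomputable section

/-! ### Commutants and multiplicity-freeness -/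

namespace Representation

section Commutant

variable {G V V' : Type*} [Group G] [AddCommGroup V] [Module ℂ V] [AddCommGroup V'] [Module ℂ V']

/-- The commutant of `ρ`, that is, its algebra of intertwining endomorphisms, is commutative. -/
def HasCommutingEnd (ρ : Representation ℂ G V) : Prop :=
  ∀ (f g : IntertwiningMap ρ ρ) (v : V), f (g v) = g (f v)

lemma HasCommutingEnd.of_equiv {ρ : Representation ℂ G V} {ρ' : Representation ℂ G V'}
    (e : ρ.Equiv ρ') (h : HasCommutingEnd ρ) : HasCommutingEnd ρ' := by
  intro f g v
  have := h (e.symm.toIntertwiningMap.comp (f.comp e.toIntertwiningMap))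
    (e.symm.toIntertwiningMap.comp (g.comp e.toIntertwiningMap)) (e.symm v)
  simpa using this

lemma hasCommutingEnd_congr {ρ : Representation ℂ G V} {ρ' : Representation ℂ G V'}
    (e : ρ.Equiv ρ') : HasCommutingEnd ρ ↔ HasCommutingEnd ρ' :=
  ⟨.of_equiv e, .of_equiv e.symm⟩

lemma IsIrreducible.nontrivial {ρ : Representation ℂ G V} (h : ρ.IsIrreducible) :
    Nontrivial V := by
  by_contra hV
  rw [not_nontrivial_iff_subsingleton] at hV
  apply bot_ne_top (α := Subrepresentation ρ)
  apply SetLike.ext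
  intro v
  rw [Subsingleton.elim v 0]
  exact ⟨fun _ => Submodule.mem_top, fun _ => Submodule.zero_mem _⟩

lemma IsIrreducible.eq_smul {ρ : Representation ℂ G V} [FiniteDimensional ℂ V]
    (h : ρ.IsIrreducible) (f : IntertwiningMap ρ ρ) : ∃ c : ℂ, ∀ v, f v = c • v := by
  obtain ⟨c, hc⟩ := (IsIrreducible.algebraMap_intertwiningMap_bijective_of_isAlgClosed
    (ρ := ρ)).2 f
  refine ⟨c, fun v => ?_⟩
  rw [← hc]
  simp

end Commutant

section DirectSum

variable {G ι V : Type*} [Group G] [DecidableEq ι] {U : ι → Type*} [∀ i, AddCommGroup (U i)]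
  [∀ i, Module ℂ (U i)] [AddCommGroup V] [Module ℂ V]

/-- The inclusion of a summand into a direct sum of representations. -/
def directSumIncl (τ : ∀ i, Representation ℂ G (U i)) (i : ι) :
    IntertwiningMap (τ i) (directSum τ) where
  toLinearMap := DirectSum.lof ℂ ι U i
  isIntertwining' g := by
    ext u
    simp [directSum_apply]

/-- The projection of a direct sum of representations onto a summand. -/
def directSumProj (τ : ∀ i, Representation ℂ G (U i)) (i : ι) :
    IntertwiningMap (directSum τ) (τ i) where
  toLinearMap := DirectSum.component ℂ ι U i
  isIntertwining' g := by
    ext j u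
    exact DirectSum.lmap_apply (fun j => τ j g) (DirectSum.lof ℂ ι U j u) i

@[simp]
lemma directSumIncl_apply (τ : ∀ i, Representation ℂ G (U i)) (i : ι) (u : U i) :
    directSumIncl τ i u = DirectSum.lof ℂ ι U i u := rfl

@[simp]
lemma directSumProj_apply (τ : ∀ i, Representation ℂ G (U i)) (i : ι) (w : ⨁ i, U i) :
    directSumProj τ i w = w i := rfl

lemma directSumIncl_injective (τ : ∀ i, Representation ℂ G (U i)) (i : ι) :
    Function.Injective (directSumIncl τ i) :=
  Function.LeftInverse.injective (g := directSumProj τ i) fun u => by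
    rw [directSumIncl_apply, directSumProj_apply, DirectSum.lof_apply]

/-- The intertwining map out of a direct sum given by intertwining maps out of the summands. -/
def directSumLift {τ : ∀ i, Representation ℂ G (U i)} {ρ : Representation ℂ G V}
    (φ : ∀ i, IntertwiningMap (τ i) ρ) : IntertwiningMap (directSum τ) ρ where
  toLinearMap := DirectSum.toModule ℂ ι V (fun i => (φ i).toLinearMap)
  isIntertwining' g := by
    ext i u
    simp [directSum_apply, IntertwiningMap.isIntertwining]

@[simp]
lemma directSumLift_lof {τ : ∀ i, Representation ℂ G (U i)} {ρ : Representation ℂ G V}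
    (φ : ∀ i, IntertwiningMap (τ i) ρ) (i : ι) (u : U i) :
    directSumLift φ (DirectSum.lof ℂ ι U i u) = φ i u := by
  show DirectSum.toModule ℂ ι V (fun i => (φ i).toLinearMap) _ = _
  simp

/-- By Schur's lemma, an endomorphism of a direct sum of pairwise inequivalent irreducible
representations is a scalar on each summand. -/
lemma exists_smul_of_directSum {τ : ∀ i, Representation ℂ G (U i)}
    [∀ i, FiniteDimensional ℂ (U i)]
    (hirr : ∀ i, (τ i).IsIrreducible) (hne : ∀ i j, i ≠ j → IsEmpty ((τ i).Equiv (τ j)))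
    (f : IntertwiningMap (directSum τ) (directSum τ)) :
    ∃ c : ι → ℂ, ∀ i u, f (DirectSum.lof ℂ ι U i u) = c i • DirectSum.lof ℂ ι U i u := by
  choose c hc using fun i => (hirr i).eq_smul
    ((directSumProj τ i).comp (f.comp (directSumIncl τ i)))
  refine ⟨c, fun i u => DFinsupp.ext fun j => ?_⟩
  have hsmul : (c i • DirectSum.lof ℂ ι U i u) j = c i • (DirectSum.lof ℂ ι U i u) j := rfl
  rcases eq_or_ne i j with rfl | hij
  · have := hc i u
    simp only [IntertwiningMap.comp_apply, directSumIncl_apply, directSumProj_apply] at this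
    rw [this, hsmul, DirectSum.lof_apply]
  · have := hirr i
    have := hirr j
    have hE := hne i j hij
    have h0 : (directSumProj τ j).comp (f.comp (directSumIncl τ i)) = 0 := Subsingleton.elim _ _
    have h1 : ((directSumProj τ j).comp (f.comp (directSumIncl τ i))) u = 0 := by rw [h0]; rfl
    simp only [IntertwiningMap.comp_apply, directSumIncl_apply, directSumProj_apply] at h1
    rw [h1, hsmul, DirectSum.lof_eq_of, DirectSum.of_eq_of_ne _ _ _ hij.symm, smul_zero]

lemma hasCommutingEnd_directSum {τ : ∀ i, Representation ℂ G (U i)}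
    [∀ i, FiniteDimensional ℂ (U i)]
    (hirr : ∀ i, (τ i).IsIrreducible) (hne : ∀ i j, i ≠ j → IsEmpty ((τ i).Equiv (τ j))) :
    HasCommutingEnd (directSum τ) := by
  intro f g v
  obtain ⟨c, hc⟩ := exists_smul_of_directSum hirr hne f
  obtain ⟨d, hd⟩ := exists_smul_of_directSum hirr hne g
  suffices h : f.toLinearMap ∘ₗ g.toLinearMap = g.toLinearMap ∘ₗ f.toLinearMap from
    LinearMap.congr_fun h v
  ext i u : 2
  simp only [LinearMap.comp_apply, IntertwiningMap.toLinearMap_apply, hc, hd, map_smul]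
  rw [smul_comm]

/-- Two equivalent nonzero summands `τ i`, `τ j` yield two endomorphisms that do not commute:
the projection onto `τ i` and the map that moves `τ i` to `τ j`. -/
lemma HasCommutingEnd.isEmpty_equiv {τ : ∀ i, Representation ℂ G (U i)}
    (h : HasCommutingEnd (directSum τ)) {i j : ι} (hij : i ≠ j) [Nontrivial (U i)] :
    IsEmpty ((τ i).Equiv (τ j)) := by
  refine ⟨fun e => ?_⟩
  obtain ⟨u, hu⟩ := exists_ne (0 : U i)
  have := h ((directSumIncl τ i).comp (directSumProj τ i))
    ((directSumIncl τ j).comp (e.toIntertwiningMap.comp (directSumProj τ i)))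
    (DirectSum.lof ℂ ι U i u)
  simp only [IntertwiningMap.comp_apply, directSumIncl_apply, directSumProj_apply,
    DirectSum.lof_apply, Equiv.coe_toIntertwiningMap] at this
  rw [DirectSum.lof_eq_of ℂ ι U j, DirectSum.of_eq_of_ne _ _ _ hij] at this
  have h2 := DFunLike.congr_fun (this.symm.trans (map_zero _)) j
  rw [DirectSum.of_eq_same] at h2
  exact hu ((EmbeddingLike.map_eq_zero_iff (f := e)).1 h2)

/-- By Maschke's theorem, a subrepresentation is the image of an equivariant projection. -/
lemma exists_projection [Finite G] {ρ : Representation ℂ G V} (N : Subrepresentation ρ) :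
    ∃ q : IntertwiningMap ρ ρ, (∀ v, q v ∈ N) ∧ ∀ v ∈ N, q v = v := by
  obtain ⟨M, hM⟩ := exists_isCompl N
  have hM' : IsCompl N.toSubmodule M.toSubmodule :=
    ⟨disjoint_iff.2 (congrArg Subrepresentation.toSubmodule hM.inf_eq_bot),
      codisjoint_iff.2 (congrArg Subrepresentation.toSubmodule hM.sup_eq_top)⟩
  refine ⟨⟨N.toSubmodule.projection M.toSubmodule hM', fun g => ?_⟩, fun v => ?_, fun v hv => ?_⟩
  · refine ((LinearMap.IsIdempotentElem.commute_iff
      (Submodule.isIdempotentElem_projection hM')).2 ?_).eq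
    rw [Submodule.range_projection, Submodule.ker_projection]
    exact ⟨N.apply_mem_toSubmodule g, M.apply_mem_toSubmodule g⟩
  · exact Submodule.projection_apply_mem hM' v
  · exact Submodule.projection_apply_left hM' ⟨v, hv⟩

/-- A map out of a direct sum of pairwise inequivalent irreducible representations is injective
if it is injective on each summand: an equivariant projection onto its kernel is a scalar on each
summand, and a nonzero scalar would put the summand into the kernel. -/
lemma directSumLift_injective [Finite G] {τ : ∀ i, Representation ℂ G (U i)}
    [∀ i, FiniteDimensional ℂ (U i)] {ρ : Representation ℂ G V}
    (hirr : ∀ i, (τ i).IsIrreducible) (hne : ∀ i j, i ≠ j → IsEmpty ((τ i).Equiv (τ j)))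
    (φ : ∀ i, IntertwiningMap (τ i) ρ) (hφ : ∀ i, Function.Injective (φ i)) :
    Function.Injective (directSumLift φ) := by
  obtain ⟨q, hq, hq'⟩ := exists_projection (directSumLift φ).ker
  obtain ⟨c, hc⟩ := exists_smul_of_directSum hirr hne q
  have hq0 : q.toLinearMap = 0 := by
    ext i u : 2
    have h1 : directSumLift φ (q (DirectSum.lof ℂ ι U i u)) = 0 := hq _
    rw [hc, map_smul, directSumLift_lof, ← map_smul] at h1
    have h2 : c i • u = 0 := hφ i (h1.trans (map_zero _).symm)
    show q (DirectSum.lof ℂ ι U i u) = 0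
    rw [hc, ← map_smul, h2, map_zero]
  rw [injective_iff_map_eq_zero]
  intro w hw
  rw [← hq' w hw]
  exact LinearMap.congr_fun hq0 w

end DirectSum

section MultiplicityFree

variable {G V : Type*} [Group G] [AddCommGroup V] [Module ℂ V]

/-- An internal direct sum decomposition into subrepresentations, as an equivalence. -/
def equivOfIsInternal {ρ : Representation ℂ G V} {ι : Type*} [DecidableEq ι]
    (W : ι → Subrepresentation ρ)
    (hW : DirectSum.IsInternal (fun i => (W i).toSubmodule)) :
    (directSum (fun i => (W i).toRepresentation)).Equiv ρ :=
  (directSumLift (fun i => (⟨(W i).toSubmodule.subtype, fun _ => rfl⟩ :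
    IntertwiningMap (W i).toRepresentation ρ))).ofBijective hW

lemma isIrreducible_of_isAtom {ρ : Representation ℂ G V} {W : Subrepresentation ρ}
    (hW : IsAtom W) : W.toRepresentation.IsIrreducible := by
  have hex : ∃ w ∈ W, w ≠ 0 := by
    by_contra! h
    exact hW.1 (le_bot_iff.1 fun v hv => h v hv)
  obtain ⟨w, hw, hw0⟩ := hex
  refine { exists_pair_ne := ⟨⊥, ⊤, fun hbt => hw0 ?_⟩, eq_bot_or_eq_top := fun N => ?_ }
  · have hmem : (⟨w, hw⟩ : W.toSubmodule) ∈ (⊤ : Subrepresentation W.toRepresentation) :=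
      Submodule.mem_top
    rw [← hbt] at hmem
    exact congrArg Subtype.val (show (⟨w, hw⟩ : W.toSubmodule) = 0 from hmem)
  · let M : Subrepresentation ρ :=
      { toSubmodule := N.toSubmodule.map W.toSubmodule.subtype
        apply_mem_toSubmodule := by
          rintro g _ ⟨v, hv, rfl⟩
          exact ⟨W.toRepresentation g v, N.apply_mem_toSubmodule g hv, rfl⟩ }
    have hMW : M ≤ W := Submodule.map_subtype_le W.toSubmodule N.toSubmodule
    rcases hW.le_iff.1 hMW with hM | hM
    · left
      refine le_bot_iff.1 fun v hv => ?_
      have hv' : v.1 ∈ M := ⟨v, hv, rfl⟩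
      rw [hM] at hv'
      exact Subtype.ext hv'
    · right
      refine top_le_iff.1 fun v _ => ?_
      have hv' : v.1 ∈ M := hM.symm.le v.2
      obtain ⟨v', hv', h⟩ := hv'
      rwa [← Subtype.ext h]

/-- By Schur's lemma, endomorphisms of a multiplicity-free representation act by scalars on the
summands and so commute. Conversely, in a decomposition given by Maschke's theorem two equivalent
summands would yield endomorphisms that do not commute. -/
theorem isMultiplicityFree_iff_hasCommutingEnd [Finite G] [FiniteDimensional ℂ V]
    (ρ : Representation ℂ G V) : IsMultiplicityFree ρ ↔ HasCommutingEnd ρ := by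
  constructor
  · rintro ⟨n, W, hint, hirr, hne⟩
    exact (hasCommutingEnd_directSum hirr hne).of_equiv (equivOfIsInternal W hint)
  · intro h
    have : Module.Finite (MonoidAlgebra ℂ G) ρ.asModule :=
      Module.Finite.of_restrictScalars_finite ℂ _ _
    obtain ⟨s, hind, hsup, hsimple⟩ :=
      IsSemisimpleModule.exists_sSupIndep_sSup_simples_eq_top (MonoidAlgebra ℂ G) ρ.asModule
    have : Finite s := WellFoundedGT.finite_of_sSupIndep hind
    let e := Finite.equivFin s
    let W : Fin (Nat.card s) → Subrepresentation ρ := fun i =>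
      Subrepresentation.ofSubmodule' (e.symm i).1
    have hint' : DirectSum.IsInternal (fun i => (e.symm i).1) := by
      refine DirectSum.isInternal_submodule_of_iSupIndep_of_iSup_eq_top ?_ ?_
      · exact ((sSupIndep_iff _).1 hind).comp e.symm.injective
      · rw [e.symm.surjective.iSup_comp (fun x : s => x.1), ← sSup_eq_iSup', hsup]
    have hint : DirectSum.IsInternal (fun i => (W i).toSubmodule) := hint'
    have hirr : ∀ i, (W i).toRepresentation.IsIrreducible := by
      intro i
      apply isIrreducible_of_isAtom
      rw [← OrderIso.isAtom_iff Subrepresentation.subrepresentationSubmoduleOrderIso]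
      exact isSimpleModule_iff_isAtom.1 (hsimple _ (e.symm i).2)
    refine ⟨_, W, hint, hirr, fun i j hij => ?_⟩
    have := (hirr i).nontrivial
    exact (h.of_equiv (equivOfIsInternal W hint).symm).isEmpty_equiv hij

end MultiplicityFree

end Representation

/-! ### Permutation representations -/

section PermRep

open Representation

variable {G X X' : Type*} [Group G] [MulAction G X] [MulAction G X']

@[simp]
lemma permRep_apply (g : G) (f : X → ℂ) (x : X) : permRep G X g f x = f (g⁻¹ • x) := rfl

/-- An equivariant bijection identifies the permutation representations. -/
def permRepCongr (e : X ≃ X') (he : ∀ (g : G) x, e (g • x) = g • e x) :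
    (permRep G X).Equiv (permRep G X') :=
  .mk (LinearEquiv.funCongrLeft ℂ ℂ e.symm) fun g => by
    ext f x
    show f (g⁻¹ • e.symm x) = f (e.symm (g⁻¹ • x))
    congr 1
    apply e.injective
    rw [he, e.apply_symm_apply, e.apply_symm_apply]

/-- The functions on a transitive `G`-set are those on the quotient by a point stabilizer. -/
def permRepQuotientEquiv [MulAction.IsPretransitive G X] (x₀ : X) {K : Subgroup G}
    (hK : MulAction.stabilizer G x₀ = K) : (permRep G (G ⧸ K)).Equiv (permRep G X) :=
  permRepCongr
    (Equiv.ofBijective (fun q : G ⧸ K => MulAction.ofQuotientStabilizer G x₀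
      (Subgroup.quotientEquivOfEq hK.symm q)) <| by
        subst hK
        refine ⟨fun p q h => ?_, fun x => ?_⟩
        · simpa using MulAction.injective_ofQuotientStabilizer G x₀ h
        · obtain ⟨g, rfl⟩ := MulAction.exists_smul_eq G x₀ x
          exact ⟨QuotientGroup.mk g, rfl⟩)
    (by
      subst hK
      intro g q
      induction q using QuotientGroup.induction_on with
      | H q => exact mul_smul g q x₀)

/-- If there were two orbits, then the projection onto the functions supported on the first one
would not commute with the operator that sums a function over the first orbit and places the
constant result on the rest of `X`. -/
lemma isPretransitive_of_hasCommutingEnd [Finite X] (x₀ : X)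
    (h : HasCommutingEnd (permRep G X)) : MulAction.IsPretransitive G X := by
  classical
  cases nonempty_fintype X
  let O : Set X := MulAction.orbit G x₀
  have hO : ∀ (g : G) (x : X), g • x ∈ O ↔ x ∈ O := fun g x => by
    rw [MulAction.mem_orbit_symm, MulAction.orbit_smul, MulAction.mem_orbit_symm]
  let P : IntertwiningMap (permRep G X) (permRep G X) :=
    { toFun := fun f x => if x ∈ O then f x else 0
      map_add' := fun f f' => by ext x; by_cases hx : x ∈ O <;> simp [hx]
      map_smul' := fun c f => by ext x; by_cases hx : x ∈ O <;> simp [hx]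
      isIntertwining' := fun g => by
        refine LinearMap.ext fun f => funext fun x => ?_
        show (if x ∈ O then f (g⁻¹ • x) else 0) = if g⁻¹ • x ∈ O then f (g⁻¹ • x) else 0
        simp only [hO] }
  let T : IntertwiningMap (permRep G X) (permRep G X) :=
    { toFun := fun f x => if x ∈ O then 0 else ∑ y, if y ∈ O then f y else 0
      map_add' := fun f f' => by
        ext x; by_cases hx : x ∈ O <;> simp [hx, ← Finset.sum_add_distrib, ← ite_add_zero]
      map_smul' := fun c f => by
        ext x; by_cases hx : x ∈ O <;> simp [hx, Finset.mul_sum]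
      isIntertwining' := fun g => by
        refine LinearMap.ext fun f => funext fun x => ?_
        show (if x ∈ O then 0 else ∑ y, if y ∈ O then f (g⁻¹ • y) else 0) =
          if g⁻¹ • x ∈ O then 0 else ∑ y, if y ∈ O then f y else 0
        simp only [hO]
        congr 1
        refine Fintype.sum_equiv (MulAction.toPerm g⁻¹) _ _ fun y => ?_
        simp only [MulAction.toPerm_apply, hO] }
  have hx₀ : x₀ ∈ O := MulAction.mem_orbit_self x₀
  have hall : ∀ x, x ∈ O := by
    intro x
    by_contra hx
    have h1 := congrFun (h P T (Pi.single x₀ 1)) x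
    have h2 : P (T (Pi.single x₀ 1)) x = 0 := if_neg hx
    have h3 : T (P (Pi.single x₀ 1)) x =
      ∑ y, if y ∈ O then (if y ∈ O then (Pi.single x₀ 1 : X → ℂ) y else 0) else 0 := if_neg hx
    rw [h2, h3, Finset.sum_eq_single x₀ (fun y _ hy => by simp [hy]) (by simp)] at h1
    simp [hx₀] at h1
  exact MulAction.isPretransitive_iff_base x₀ |>.2 fun x => hall x

end PermRep

/-! ### Weight spaces for the normal subgroup `A` of `H ⋉ A` -/

section Weights

open Representation

variable {H A V V' : Type*} [Group H] [AddCommGroup A] [DistribMulAction H A]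
  [AddCommGroup V] [Module ℂ V] [AddCommGroup V'] [Module ℂ V']

namespace SemiProd

/-- The element `(1, a)` of `H ⋉ A`. -/
def ofA (a : A) : SemiProd H A := SemidirectProduct.inl (Multiplicative.ofAdd a)

/-- The element `(h, 0)` of `H ⋉ A`. -/
def ofH (h : H) : SemiProd H A := SemidirectProduct.inr h

lemma ofA_add (a b : A) : (ofA (a + b) : SemiProd H A) = ofA a * ofA b :=
  map_mul SemidirectProduct.inl _ _

lemma ofH_mul (h k : H) : (ofH (h * k) : SemiProd H A) = ofH h * ofH k :=
  map_mul SemidirectProduct.inr _ _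

lemma ofH_one : (ofH 1 : SemiProd H A) = 1 := rfl

lemma ofH_inv (h : H) : (ofH h⁻¹ : SemiProd H A) = (ofH h)⁻¹ := map_inv SemidirectProduct.inr _

lemma ofA_neg (a : A) : (ofA (-a) : SemiProd H A) = (ofA a)⁻¹ :=
  map_inv SemidirectProduct.inl _

lemma ofH_mul_ofA (h : H) (a : A) :
    (ofH h * ofA a : SemiProd H A) = ofA (h • a) * ofH h := by
  have h1 : (ofA (h • a) : SemiProd H A) = ofH h * ofA a * ofH h⁻¹ :=
    SemidirectProduct.inl_aut (φ := actionHom H A) h (Multiplicative.ofAdd a)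
  rw [h1, ofH_inv, inv_mul_cancel_right]

lemma eq_ofA_mul_ofH (g : SemiProd H A) : g = ofA g.left.toAdd * ofH g.right :=
  (SemidirectProduct.inl_left_mul_inr_right g).symm

end SemiProd

open SemiProd

@[simp]
lemma charTranslate_apply (h : H) (ψ : AddChar A Circle) (a : A) :
    charTranslate h ψ a = ψ (h⁻¹ • a) := rfl

lemma charTranslate_one (ψ : AddChar A Circle) : charTranslate (1 : H) ψ = ψ := by
  ext a
  simp

lemma charTranslate_mul (h k : H) (ψ : AddChar A Circle) :
    charTranslate (h * k) ψ = charTranslate h (charTranslate k ψ) := by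
  ext a
  simp [mul_smul]

lemma charTranslate_inv (h : H) (ψ : AddChar A Circle) :
    charTranslate h ψ⁻¹ = (charTranslate h ψ)⁻¹ := by
  ext a
  simp

lemma charTranslate_inv_eq_iff (h : H) (ψ χ : AddChar A Circle) :
    charTranslate h⁻¹ ψ = χ ↔ charTranslate h χ = ψ := by
  constructor
  · rintro rfl
    rw [← charTranslate_mul, mul_inv_cancel, charTranslate_one]
  · rintro rfl
    rw [← charTranslate_mul, inv_mul_cancel, charTranslate_one]

/-- The space of vectors of weight `ψ` under the subgroup `A` of `H ⋉ A`. -/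
def weightSpace (ρ : Representation ℂ (SemiProd H A) V) (ψ : AddChar A Circle) :
    Submodule ℂ V where
  carrier := {v | ∀ a, ρ (ofA a) v = (ψ a : ℂ) • v}
  add_mem' {v w} hv hw a := by rw [map_add, hv a, hw a, smul_add]
  zero_mem' a := by simp
  smul_mem' c v hv a := by rw [map_smul, hv a, smul_comm]

variable {ρ : Representation ℂ (SemiProd H A) V} {ρ' : Representation ℂ (SemiProd H A) V'}
  {ψ χ : AddChar A Circle}

lemma ofH_apply_mem_weightSpace {v : V} (hv : v ∈ weightSpace ρ ψ) (h : H) :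
    ρ (ofH h) v ∈ weightSpace ρ (charTranslate h ψ) := by
  intro a
  have h1 : (ofA a * ofH h : SemiProd H A) = ofH h * ofA (h⁻¹ • a) := by
    rw [ofH_mul_ofA, smul_inv_smul]
  rw [← Module.End.mul_apply, ← map_mul, h1, map_mul, Module.End.mul_apply, hv, map_smul]
  rfl

lemma map_mem_weightSpace (f : IntertwiningMap ρ ρ') {v : V} (hv : v ∈ weightSpace ρ ψ) :
    f v ∈ weightSpace ρ' ψ := by
  intro a
  rw [← IntertwiningMap.isIntertwining, hv, map_smul]

lemma eq_zero_of_mem_weightSpace {v : V} (hv : v ∈ weightSpace ρ ψ) (hv' : v ∈ weightSpace ρ χ)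
    (h : ψ ≠ χ) : v = 0 := by
  obtain ⟨a, ha⟩ := DFunLike.ne_iff.1 h
  have h1 : ((ψ a : ℂ) - χ a) • v = 0 := by rw [sub_smul, ← hv a, ← hv' a, sub_self]
  rcases smul_eq_zero.1 h1 with h2 | h2
  · exact absurd (Circle.ext (sub_eq_zero.1 h2)) ha
  · exact h2

/-- The representation of a subgroup `T` of `H` that fixes `ψ` on the vectors of weight `ψ`. -/
def weightRep (ρ : Representation ℂ (SemiProd H A) V) (ψ : AddChar A Circle) (T : Subgroup H)
    (hT : ∀ h ∈ T, charTranslate h ψ = ψ) : Representation ℂ T (weightSpace ρ ψ) where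
  toFun t := (ρ (ofH t.1)).restrict (fun v hv => by
    have := ofH_apply_mem_weightSpace hv t.1
    rwa [hT t.1 t.2] at this)
  map_one' := by
    ext v
    show ρ (ofH 1) v.1 = v.1
    rw [ofH_one, map_one]
    rfl
  map_mul' s t := by
    ext v
    show ρ (ofH (s.1 * t.1)) v.1 = ρ (ofH s.1) (ρ (ofH t.1) v.1)
    rw [ofH_mul, map_mul]
    rfl

@[simp]
lemma weightRep_apply_coe {T : Subgroup H} (hT : ∀ h ∈ T, charTranslate h ψ = ψ) (t : T)
    (v : weightSpace ρ ψ) : (weightRep ρ ψ T hT t v : V) = ρ (ofH t.1) v := rfl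

section Projection

variable [Fintype A]

/-- The projection `|A|⁻¹ ∑ₐ ψ(a)⁻¹ ρ(a)` onto the vectors of weight `ψ`. -/
def weightProj (ρ : Representation ℂ (SemiProd H A) V) (ψ : AddChar A Circle) : V →ₗ[ℂ] V :=
  (Fintype.card A : ℂ)⁻¹ • ∑ a : A, (ψ (-a) : ℂ) • ρ (ofA a)

lemma weightProj_apply (ρ : Representation ℂ (SemiProd H A) V) (ψ : AddChar A Circle) (v : V) :
    weightProj ρ ψ v = (Fintype.card A : ℂ)⁻¹ • ∑ a : A, (ψ (-a) : ℂ) • ρ (ofA a) v := by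
  simp [weightProj, LinearMap.sum_apply]

lemma weightProj_ofA (a : A) (v : V) :
    weightProj ρ ψ (ρ (ofA a) v) = (ψ a : ℂ) • weightProj ρ ψ v := by
  rw [weightProj_apply ρ ψ, weightProj_apply ρ ψ, smul_comm (ψ a : ℂ),
    Finset.smul_sum (r := (ψ a : ℂ))]
  congr 1
  refine Fintype.sum_equiv (Equiv.addRight a) _ _ fun b => ?_
  have hb : -b = a + -(b + a) := by abel
  rw [Equiv.coe_addRight, ofA_add, map_mul, Module.End.mul_apply, smul_smul, ← Circle.coe_mul,
    ← AddChar.map_add_eq_mul, hb]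

lemma ofA_weightProj (a : A) (v : V) :
    ρ (ofA a) (weightProj ρ ψ v) = weightProj ρ ψ (ρ (ofA a) v) := by
  simp only [weightProj_apply, map_smul, map_sum]
  congr 1
  refine Finset.sum_congr rfl fun b _ => ?_
  rw [← Module.End.mul_apply, ← Module.End.mul_apply, ← map_mul, ← map_mul, ← ofA_add, ← ofA_add,
    add_comm]

lemma weightProj_mem (ψ : AddChar A Circle) (v : V) : weightProj ρ ψ v ∈ weightSpace ρ ψ :=
  fun a => by rw [ofA_weightProj, weightProj_ofA]

lemma weightProj_of_mem {v : V} (hv : v ∈ weightSpace ρ ψ) : weightProj ρ ψ v = v := by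
  have h : ∀ a : A, (ψ (-a) : ℂ) • ρ (ofA a) v = v := fun a => by
    rw [hv a, smul_smul, ← Circle.coe_mul, ← AddChar.map_add_eq_mul, neg_add_cancel,
      AddChar.map_zero_eq_one, Circle.coe_one, one_smul]
  rw [weightProj_apply, Finset.sum_congr rfl fun a _ => h a, Finset.sum_const, Finset.card_univ,
    ← Nat.cast_smul_eq_nsmul ℂ, smul_smul, inv_mul_cancel₀ (by simp), one_smul]

lemma weightProj_of_mem_of_ne {v : V} (hv : v ∈ weightSpace ρ χ) (h : ψ ≠ χ) :
    weightProj ρ ψ v = 0 := by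
  refine eq_zero_of_mem_weightSpace (weightProj_mem ψ v) (fun a => ?_) h
  rw [ofA_weightProj, hv a, map_smul]

/-- The weight spaces span: by the orthogonality of characters, the projections onto them add up to
the identity. -/
lemma iSup_weightSpace (ρ : Representation ℂ (SemiProd H A) V) :
    ⨆ ψ, weightSpace ρ ψ = ⊤ := by
  classical
  have hsum : ∀ a : A, ∑ ψ : AddChar A ℂ, (AddChar.circleEquivComplex.symm ψ (-a) : ℂ) =
      if a = 0 then (Fintype.card A : ℂ) else 0 := fun a => by
    have h := AddChar.sum_apply_eq_ite (-a)
    simp only [neg_eq_zero] at h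
    rw [← h]
    rfl
  rw [eq_top_iff]
  intro v _
  have hv : v = ∑ ψ : AddChar A ℂ, weightProj ρ (AddChar.circleEquivComplex.symm ψ) v := by
    simp only [weightProj_apply]
    rw [← Finset.smul_sum, Finset.sum_comm]
    simp only [← Finset.sum_smul, hsum, ite_smul, zero_smul, Finset.sum_ite_eq', Finset.mem_univ,
      if_true]
    rw [smul_smul, inv_mul_cancel₀ (by simp), one_smul]
    show v = ρ 1 v
    rw [map_one]
    rfl
  rw [hv]
  exact Submodule.sum_mem _ fun ψ _ => Submodule.mem_iSup_of_mem _ (weightProj_mem _ v)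

end Projection

section Extension

variable [Fintype A] [Fintype H]

variable {T : Subgroup H} {hT : ∀ h ∈ T, charTranslate h ψ = ψ}

/-- The linear map `|T|⁻¹ ∑ₕ ρ(h) φ p ρ(h⁻¹)`, where `φ` is an endomorphism of the vectors of
weight `ψ` and `p` is the projection onto these vectors. -/
def weightExtendLinear (φ : IntertwiningMap (weightRep ρ ψ T hT) (weightRep ρ ψ T hT)) :
    V →ₗ[ℂ] V :=
  (Nat.card T : ℂ)⁻¹ • ∑ h : H, ρ (ofH h) ∘ₗ (weightSpace ρ ψ).subtype ∘ₗ
    φ.toLinearMap ∘ₗ (weightProj ρ ψ).codRestrict _ (weightProj_mem ψ) ∘ₗ ρ (ofH h⁻¹)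

lemma weightExtendLinear_apply
    (φ : IntertwiningMap (weightRep ρ ψ T hT) (weightRep ρ ψ T hT)) (v : V) :
    weightExtendLinear φ v = (Nat.card T : ℂ)⁻¹ • ∑ h : H, ρ (ofH h)
      (φ ⟨weightProj ρ ψ (ρ (ofH h⁻¹) v), weightProj_mem ψ _⟩ : V) := by
  simp only [weightExtendLinear, LinearMap.smul_apply, LinearMap.sum_apply]
  rfl

/-- The extension of a `T`-endomorphism `φ` of the vectors of weight `ψ` to an endomorphism of the
whole representation. -/
def weightExtend (φ : IntertwiningMap (weightRep ρ ψ T hT) (weightRep ρ ψ T hT)) :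
    IntertwiningMap ρ ρ where
  toLinearMap := weightExtendLinear φ
  isIntertwining' g := by
    have hH : ∀ (k : H) (v : V),
        weightExtendLinear φ (ρ (ofH k) v) = ρ (ofH k) (weightExtendLinear φ v) := by
      intro k v
      simp only [weightExtendLinear_apply, map_smul, map_sum]
      congr 1
      refine Fintype.sum_equiv (Equiv.mulLeft k⁻¹) _ _ fun h => ?_
      have h1 : ρ (ofH (k⁻¹ * h)⁻¹) v = ρ (ofH h⁻¹) (ρ (ofH k) v) := by
        rw [mul_inv_rev, inv_inv, ofH_mul, map_mul, Module.End.mul_apply]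
      simp only [Equiv.coe_mulLeft, h1]
      rw [← Module.End.mul_apply (ρ (ofH k)), ← map_mul, ← ofH_mul, mul_inv_cancel_left]
    have hA : ∀ (a : A) (v : V),
        weightExtendLinear φ (ρ (ofA a) v) = ρ (ofA a) (weightExtendLinear φ v) := by
      intro a v
      simp only [weightExtendLinear_apply, map_smul, map_sum]
      congr 1
      refine Finset.sum_congr rfl fun h _ => ?_
      have h1 : ρ (ofH h⁻¹) (ρ (ofA a) v) = ρ (ofA (h⁻¹ • a)) (ρ (ofH h⁻¹) v) := by
        rw [← Module.End.mul_apply, ← map_mul, ofH_mul_ofA, map_mul, Module.End.mul_apply]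
      have h2 : (⟨weightProj ρ ψ (ρ (ofH h⁻¹) (ρ (ofA a) v)), weightProj_mem ψ _⟩ :
          weightSpace ρ ψ) = (ψ (h⁻¹ • a) : ℂ) •
            ⟨weightProj ρ ψ (ρ (ofH h⁻¹) v), weightProj_mem ψ _⟩ :=
        Subtype.ext ((congrArg _ h1).trans (weightProj_ofA _ _))
      rw [h2, map_smul, ofH_apply_mem_weightSpace (Subtype.property _) h a, Submodule.coe_smul,
        map_smul]
      rfl
    ext v
    conv_lhs => rw [eq_ofA_mul_ofH g]
    conv_rhs => rw [eq_ofA_mul_ofH g]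
    simp only [LinearMap.comp_apply, map_mul, Module.End.mul_apply]
    rw [hA, hH]

/-- When `T` is the full stabilizer of `ψ`, `weightExtend φ` does extend `φ`. -/
lemma weightExtend_coe (hT' : ∀ h, charTranslate h ψ = ψ → h ∈ T)
    (φ : IntertwiningMap (weightRep ρ ψ T hT) (weightRep ρ ψ T hT)) (v : weightSpace ρ ψ) :
    weightExtend φ (v : V) = φ v := by
  classical
  -- The translate `ρ(h⁻¹) v` has weight `ψ` if `h ∈ T`, and another weight otherwise.
  have key : ∀ h : H,
      ρ (ofH h) (φ ⟨weightProj ρ ψ (ρ (ofH h⁻¹) (v : V)), weightProj_mem ψ _⟩ : V) =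
      if h ∈ T then (φ v : V) else 0 := by
    intro h
    have hmem := ofH_apply_mem_weightSpace v.2 h⁻¹
    split_ifs with hh
    · have h1 : (⟨weightProj ρ ψ (ρ (ofH h⁻¹) (v : V)), weightProj_mem ψ _⟩ : weightSpace ρ ψ) =
          weightRep ρ ψ T hT (⟨h, hh⟩ : T)⁻¹ v := by
        rw [hT _ (T.inv_mem hh)] at hmem
        exact Subtype.ext (weightProj_of_mem hmem)
      rw [h1, IntertwiningMap.isIntertwining, weightRep_apply_coe, ← Module.End.mul_apply,
        ← map_mul, ← ofH_mul]
      show ρ (ofH (h * h⁻¹)) (φ v : V) = φ v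
      rw [mul_inv_cancel, ofH_one, map_one]
      rfl
    · have h1 : (⟨weightProj ρ ψ (ρ (ofH h⁻¹) (v : V)), weightProj_mem ψ _⟩ : weightSpace ρ ψ) =
          0 := by
        refine Subtype.ext (weightProj_of_mem_of_ne hmem fun h2 => hh (hT' h ?_))
        rw [← charTranslate_inv_eq_iff]
        exact h2.symm
      rw [h1, map_zero, Submodule.coe_zero, map_zero]
  show weightExtendLinear φ (v : V) = _
  rw [weightExtendLinear_apply, Finset.sum_congr rfl fun h _ => key h, Finset.sum_ite,
    Finset.sum_const_zero, add_zero, Finset.sum_const, ← Nat.cast_smul_eq_nsmul ℂ, smul_smul,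
    Nat.card_eq_fintype_card, Fintype.card_subtype, inv_mul_cancel₀, one_smul]
  rw [← Fintype.card_subtype]
  exact Nat.cast_ne_zero.2 (Fintype.card_ne_zero (α := T))

end Extension

section Commutant

variable [Finite A]

/-- Endomorphisms of a representation of `H ⋉ A` restrict to the weight spaces, and each
endomorphism of a weight space extends. -/
lemma Representation.HasCommutingEnd.on_weightSpace [Finite H] (h : HasCommutingEnd ρ)
    (T : Subgroup H)
    (hT : ∀ h ∈ T, charTranslate h ψ = ψ) (hT' : ∀ h, charTranslate h ψ = ψ → h ∈ T) :
    HasCommutingEnd (weightRep ρ ψ T hT) := by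
  cases nonempty_fintype A
  cases nonempty_fintype H
  intro f g v
  apply Subtype.ext
  have := h (weightExtend f) (weightExtend g) v
  rwa [weightExtend_coe hT', weightExtend_coe hT', weightExtend_coe hT', weightExtend_coe hT']
    at this

/-- The restriction of an endomorphism to a weight space. -/
def weightRestrict (f : IntertwiningMap ρ ρ) (ψ : AddChar A Circle) (T : Subgroup H)
    (hT : ∀ h ∈ T, charTranslate h ψ = ψ) :
    IntertwiningMap (weightRep ρ ψ T hT) (weightRep ρ ψ T hT) where
  toLinearMap := f.toLinearMap.restrict fun _ hv => map_mem_weightSpace f hv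
  isIntertwining' t := by
    ext v
    exact f.isIntertwining _ _ (ofH t.1) v.1

/-- If the weights in `P` meet every `H`-orbit of weights, then the vectors with weight in `P`
generate the representation. -/
lemma eq_top_of_weightSpace_le (N : Subrepresentation ρ) (P : Set (AddChar A Circle))
    (hP : ∀ ψ, ∀ v ∈ weightSpace ρ ψ, v ≠ 0 → ∃ h : H, charTranslate h ψ ∈ P)
    (hN : ∀ ψ ∈ P, ∀ v ∈ weightSpace ρ ψ, v ∈ N) (v : V) : v ∈ N := by
  cases nonempty_fintype A
  suffices h : ⨆ ψ, weightSpace ρ ψ ≤ N.toSubmodule by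
    rw [iSup_weightSpace] at h
    exact h Submodule.mem_top
  refine iSup_le fun ψ v hv => ?_
  by_cases h0 : v = 0
  · exact h0 ▸ N.toSubmodule.zero_mem
  obtain ⟨h, hh⟩ := hP ψ v hv h0
  have h1 := N.apply_mem_toSubmodule (ofH h)⁻¹ (hN _ hh _ (ofH_apply_mem_weightSpace hv h))
  rwa [Representation.inv_self_apply] at h1

/-- The commutant is determined on the vectors with weight in a set that meets every `H`-orbit of
weights. -/
lemma hasCommutingEnd_of_weightRep (P : Set (AddChar A Circle))
    (hP : ∀ ψ, ∀ v ∈ weightSpace ρ ψ, v ≠ 0 → ∃ h : H, charTranslate h ψ ∈ P)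
    (hcomm : ∀ ψ ∈ P, ∃ (T : Subgroup H) (hT : ∀ h ∈ T, charTranslate h ψ = ψ),
      HasCommutingEnd (weightRep ρ ψ T hT)) : HasCommutingEnd ρ := by
  intro f g v
  have hv := eq_top_of_weightSpace_le (f.comp g - g.comp f).ker P hP (fun ψ hψ v hv => by
    obtain ⟨T, hT, hc⟩ := hcomm ψ hψ
    exact sub_eq_zero.2 (congrArg Subtype.val
      (hc (weightRestrict f _ T hT) (weightRestrict g _ T hT) ⟨v, hv⟩))) v
  exact sub_eq_zero.1 hv

end Commutant

end Weights

namespace SemidirectSystem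

open Representation SemiProd

variable {H A Y : Type*} {B : Y → Type*} [Group H] [AddCommGroup A]
  [DistribMulAction H A] [MulAction H Y] [∀ y, AddCommGroup (B y)]
  (S : SemidirectSystem H A Y B) (y₀ : Y)

/-! ### Orbits of characters -/

lemma infl_apply (θ : AddChar (B y₀) Circle) (a : A) : S.infl y₀ θ a = θ (S.π y₀ a) := rfl

lemma infl_injective : Function.Injective (S.infl y₀) := by
  intro θ χ h
  ext b
  obtain ⟨a, rfl⟩ := S.π_surjective y₀ b
  exact congrArg _ (DFunLike.congr_fun h a)

lemma infl_inv (θ : AddChar (B y₀) Circle) : S.infl y₀ θ⁻¹ = (S.infl y₀ θ)⁻¹ := by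
  ext a
  simp [infl_apply]

lemma infl_baseTranslate (k : MulAction.stabilizer H y₀) (θ : AddChar (B y₀) Circle) :
    S.infl y₀ (S.baseTranslate y₀ k θ) = charTranslate k.1 (S.infl y₀ θ) := by
  ext a
  rw [charTranslate_apply, infl_apply, infl_apply]
  congr 1
  exact congrArg θ (S.act_π' (k⁻¹ : MulAction.stabilizer H y₀).1 (k⁻¹).2 a)

lemma baseTranslate_eq_iff (k : MulAction.stabilizer H y₀) (θ χ : AddChar (B y₀) Circle) :
    S.baseTranslate y₀ k θ = χ ↔ charTranslate k.1 (S.infl y₀ θ) = S.infl y₀ χ := by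
  rw [← infl_baseTranslate, (S.infl_injective y₀).eq_iff]

/-- Any two characters of `B_{y₀}` whose inflations lie in the same `H`-orbit lie in the same
`K`-orbit. -/
def OrbitCondition : Prop :=
  ∀ (θ χ : AddChar (B y₀) Circle) (h : H),
    charTranslate h (S.infl y₀ θ) = S.infl y₀ χ → ∃ k, S.baseTranslate y₀ k θ = χ

lemma eq_iff_orbitCondition {Θ Ξ : Set (AddChar (B y₀) Circle)} (hΘ : S.IsKRepresentatives y₀ Θ)
    (hΞ : S.IsHRepresentatives y₀ Ξ) (hΞΘ : Ξ ⊆ Θ) : Ξ = Θ ↔ S.OrbitCondition y₀ := by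
  constructor
  · rintro rfl θ χ h hh
    obtain ⟨θ₁, ⟨hθ₁, k, hk⟩, -⟩ := hΘ θ
    obtain ⟨χ₁, ⟨hχ₁, l, hl⟩, -⟩ := hΘ χ
    obtain ⟨φ, -, huniq⟩ := hΞ (S.infl y₀ χ) ⟨1, χ, charTranslate_one _⟩
    have h1 := huniq (S.infl y₀ θ₁) ⟨⟨θ₁, hθ₁, rfl⟩, h * k.1, by
      rw [charTranslate_mul, (S.baseTranslate_eq_iff y₀ _ _ _).1 hk, hh]⟩
    have h2 := huniq (S.infl y₀ χ₁) ⟨⟨χ₁, hχ₁, rfl⟩, l.1, (S.baseTranslate_eq_iff y₀ _ _ _).1 hl⟩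
    have h3 : θ₁ = χ₁ := S.infl_injective y₀ (h1.trans h2.symm)
    subst h3
    refine ⟨l * k⁻¹, (S.baseTranslate_eq_iff y₀ _ _ _).2 ?_⟩
    rw [Subgroup.coe_mul, charTranslate_mul, Subgroup.coe_inv,
      (charTranslate_inv_eq_iff _ _ _).2 ((S.baseTranslate_eq_iff y₀ _ _ _).1 hk),
      (S.baseTranslate_eq_iff y₀ _ _ _).1 hl]
  · intro hcond
    refine hΞΘ.antisymm fun θ hθ => ?_
    obtain ⟨φ, ⟨⟨ξ, hξ, rfl⟩, h, hh⟩, -⟩ := hΞ (S.infl y₀ θ) ⟨1, θ, charTranslate_one _⟩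
    obtain ⟨k, hk⟩ := hcond ξ θ h hh
    have h1 : ξ = θ := (hΘ θ).unique ⟨hΞΘ hξ, k, hk⟩
      ⟨hθ, 1, (S.baseTranslate_eq_iff y₀ _ _ _).2 (charTranslate_one _)⟩
    exact h1 ▸ hξ

/-- Under the orbit condition, distinct representatives of the `K`-orbits have inflations in
distinct `H`-orbits. -/
lemma OrbitCondition.eq_of_charTranslate {S : SemidirectSystem H A Y B} {y₀ : Y}
    (hcond : S.OrbitCondition y₀) {Θ : Set (AddChar (B y₀) Circle)}
    (hΘ : S.IsKRepresentatives y₀ Θ) {θ χ : AddChar (B y₀) Circle} (hθ : θ ∈ Θ) (hχ : χ ∈ Θ)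
    {h : H} (hh : charTranslate h (S.infl y₀ θ) = S.infl y₀ χ) : θ = χ :=
  (hΘ χ).unique ⟨hθ, hcond θ χ h hh⟩
    ⟨hχ, 1, (S.baseTranslate_eq_iff y₀ _ _ _).2 (charTranslate_one _)⟩

/-- The points `y` of `Y` such that the inflation of `θ` to `A` is inflated from `B y`, as an
`H_θ`-stable subset of `Y`. -/
def fibre (θ : AddChar (B y₀) Circle) : SubMulAction (S.Hst y₀ θ) Y where
  carrier := {y | ∀ a, S.π y a = 0 → S.infl y₀ θ a = 1}
  smul_mem' t y hy a ha := by
    have h1 : S.π y (t.1⁻¹ • a) = 0 := by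
      rw [← S.act_π' t.1⁻¹ (inv_smul_smul t.1 y), show S.π (t.1 • y) a = 0 from ha, map_zero]
    have h2 := DFunLike.congr_fun (show charTranslate t.1 (S.infl y₀ θ) = _ from t.2) a
    rw [← h2, charTranslate_apply, hy _ h1]

lemma base_mem_fibre (θ : AddChar (B y₀) Circle) : y₀ ∈ S.fibre y₀ θ := fun a ha => by
  rw [infl_apply, ha, AddChar.map_zero_eq_one]

/-- A character `ψ` of `A` that is trivial on the kernel of `π y` gives, after translation by an
element taking `y` to `y₀`, a character inflated from `B_{y₀}`. -/
lemma exists_infl_eq_charTranslate {ψ : AddChar A Circle} {y : Y}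
    (hψ : ∀ a, S.π y a = 0 → ψ a = 1) {h : H} (hh : h • y = y₀) :
    ∃ χ : AddChar (B y₀) Circle, S.infl y₀ χ = charTranslate h ψ := by
  have hker : ∀ a, S.π y₀ a = 0 → charTranslate h ψ a = 1 := fun a ha => by
    refine hψ _ ?_
    show S.π y (h⁻¹ • a) = 0
    rw [← S.act_π' h⁻¹ (inv_smul_eq_iff.2 hh.symm), ha, map_zero]
  have hs := Function.surjInv_eq (S.π_surjective y₀)
  have hw : ∀ a a', S.π y₀ a = S.π y₀ a' → charTranslate h ψ a = charTranslate h ψ a' := by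
    intro a a' haa
    have h1 := hker (a - a') (by rw [map_sub, haa, sub_self])
    rwa [AddChar.map_sub_eq_div, div_eq_one] at h1
  refine ⟨{ toFun := fun b => charTranslate h ψ (Function.surjInv (S.π_surjective y₀) b)
            map_zero_eq_one' := hker _ (hs 0)
            map_add_eq_mul' := fun b b' => ?_ }, ?_⟩
  · rw [← AddChar.map_add_eq_mul]
    exact hw _ _ (by rw [map_add, hs, hs, hs])
  · ext a
    exact congrArg _ (hw _ _ (hs _))

lemma stabilizer_fibre (θ : AddChar (B y₀) Circle) :
    MulAction.stabilizer (S.Hst y₀ θ) (⟨y₀, S.base_mem_fibre y₀ θ⟩ : S.fibre y₀ θ) =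
      S.Kst y₀ θ := by
  ext t
  rw [MulAction.mem_stabilizer_iff, Subtype.ext_iff]
  exact ⟨fun h => ⟨t.2, h⟩, fun h => h.2⟩

lemma OrbitCondition.isPretransitive_fibre [MulAction.IsPretransitive H Y]
    {S : SemidirectSystem H A Y B} {y₀ : Y} (hcond : S.OrbitCondition y₀)
    (θ : AddChar (B y₀) Circle) : MulAction.IsPretransitive (S.Hst y₀ θ) (S.fibre y₀ θ) := by
  rw [MulAction.isPretransitive_iff_base (⟨y₀, S.base_mem_fibre y₀ θ⟩ : S.fibre y₀ θ)]
  rintro ⟨y, hy⟩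
  obtain ⟨h, hh⟩ := MulAction.exists_smul_eq H y y₀
  obtain ⟨χ, hχ⟩ := S.exists_infl_eq_charTranslate y₀ hy hh
  obtain ⟨k, hk⟩ := hcond θ χ h hχ.symm
  have hmem : h⁻¹ * k.1 ∈ S.Hst y₀ θ := by
    show charTranslate _ _ = _
    rw [charTranslate_mul, (S.baseTranslate_eq_iff y₀ _ _ _).1 hk, charTranslate_inv_eq_iff, hχ]
  refine ⟨⟨_, hmem⟩, Subtype.ext ?_⟩
  show (h⁻¹ * k.1) • y₀ = y
  rw [mul_smul, show k.1 • y₀ = y₀ from k.2, ← hh, inv_smul_smul]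

/-- The orbit condition holds as soon as each `H_θ` with `θ ∈ Θ` is transitive on its fibre. -/
lemma orbitCondition_of_isPretransitive {Θ : Set (AddChar (B y₀) Circle)}
    (hΘ : S.IsKRepresentatives y₀ Θ)
    (htrans : ∀ θ ∈ Θ, MulAction.IsPretransitive (S.Hst y₀ θ) (S.fibre y₀ θ)) :
    S.OrbitCondition y₀ := by
  intro θ χ h hh
  obtain ⟨θ₁, ⟨hθ₁, k, hk⟩, -⟩ := hΘ θ
  have hk' := (S.baseTranslate_eq_iff y₀ _ _ _).1 hk
  have := htrans θ₁ hθ₁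
  have hg : charTranslate (h * k.1) (S.infl y₀ θ₁) = S.infl y₀ χ := by
    rw [charTranslate_mul, hk', hh]
  have hy : (h * k.1)⁻¹ • y₀ ∈ S.fibre y₀ θ₁ := by
    intro a ha
    have h1 := DFunLike.congr_fun hg ((h * k.1) • a)
    rw [charTranslate_apply, inv_smul_smul] at h1
    rw [h1, infl_apply, ← S.act_π' (h * k.1) (smul_inv_smul _ y₀), ha, map_zero,
      AddChar.map_zero_eq_one]
  obtain ⟨s, hs⟩ := MulAction.exists_smul_eq (S.Hst y₀ θ₁)
    (⟨y₀, S.base_mem_fibre y₀ θ₁⟩ : S.fibre y₀ θ₁) ⟨_, hy⟩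
  have hs' : s.1 • y₀ = (h * k.1)⁻¹ • y₀ := congrArg Subtype.val hs
  have hl : h * k.1 * s.1 ∈ MulAction.stabilizer H y₀ := by
    show (h * k.1 * s.1) • y₀ = y₀
    rw [mul_smul, hs', smul_inv_smul]
  refine ⟨⟨_, hl⟩ * k⁻¹, (S.baseTranslate_eq_iff y₀ _ _ _).2 ?_⟩
  rw [Subgroup.coe_mul, Subgroup.coe_inv, charTranslate_mul,
    (charTranslate_inv_eq_iff _ _ _).2 hk', charTranslate_mul,
    show charTranslate s.1 (S.infl y₀ θ₁) = _ from s.2, hg]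

/-! ### The weight spaces of `L(X)` -/

/-- The point `(y, b)` of `X`. -/
def pt (y : Y) (b : B y) : S.Space := ⟨y, b⟩

lemma ofA_smul_pt (a : A) (y : Y) (b : B y) :
    (ofA a : SemiProd H A) • S.pt y b = S.pt y (S.π y a + b) := by
  have key : ∀ (z : Y) (e : (1 : H) • y = z) (_ : z = y),
      S.pt z (S.π z a + S.act 1 e b) = S.pt y (S.π y a + b) := by
    intro z e e'
    subst e'
    rw [S.act_one z b]
  exact key _ rfl (one_smul H y)

lemma ofH_smul_pt (h : H) (y : Y) (b : B y) :
    (ofH h : SemiProd H A) • S.pt y b = S.pt (h • y) (S.act h rfl b) := by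
  show S.pt (h • y) (S.π (h • y) 0 + S.act h rfl b) = _
  rw [map_zero, zero_add]

lemma smul_pt (g : SemiProd H A) (y : Y) (b : B y) :
    g • S.pt y b = S.pt (g.right • y) (S.π _ g.left.toAdd + S.act g.right rfl b) := rfl

lemma mem_weightSpace_permRep {ψ : AddChar A Circle} {f : S.Space → ℂ} :
    f ∈ weightSpace (permRep (SemiProd H A) S.Space) ψ ↔
      ∀ y a b, f (S.pt y (S.π y a + b)) = (ψ (-a) : ℂ) * f (S.pt y b) := by
  constructor
  · intro hf y a b
    have h1 := congrFun (hf (-a)) (S.pt y b)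
    rwa [permRep_apply, ← ofA_neg, neg_neg, ofA_smul_pt] at h1
  · intro hf a
    refine funext fun x => ?_
    obtain ⟨y, b⟩ := x
    have h1 := hf y (-a) b
    rw [neg_neg, ← ofA_smul_pt, ofA_neg] at h1
    exact h1

/-- A weight `ψ` of `L(X)` with a weight vector that does not vanish above `y` is trivial on the
kernel of `π y`. -/
lemma eq_one_of_mem_weightSpace {ψ : AddChar A Circle} {f : S.Space → ℂ}
    (hf : f ∈ weightSpace (permRep (SemiProd H A) S.Space) ψ) {y : Y} {b : B y}
    (hb : f (S.pt y b) ≠ 0) (a : A) (ha : S.π y a = 0) : ψ a = 1 := by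
  have h1 := S.mem_weightSpace_permRep.1 hf y (-a) b
  rw [map_neg, ha, neg_zero, zero_add, neg_neg] at h1
  exact Circle.ext (mul_right_cancel₀ hb (h1.symm.trans (one_mul _).symm))

/-- Every weight of `L(X)` is in the `H`-orbit of the inflation of the conjugate of an element
of `Θ`. -/
lemma exists_charTranslate_mem [MulAction.IsPretransitive H Y] {Θ : Set (AddChar (B y₀) Circle)}
    (hΘ : S.IsKRepresentatives y₀ Θ) (ψ : AddChar A Circle) (f : S.Space → ℂ)
    (hf : f ∈ weightSpace (permRep (SemiProd H A) S.Space) ψ) (hf0 : f ≠ 0) :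
    ∃ h : H, charTranslate h ψ ∈ (fun θ => S.infl y₀ θ⁻¹) '' Θ := by
  obtain ⟨⟨y, b⟩, hb⟩ := Function.ne_iff.1 hf0
  obtain ⟨h, hh⟩ := MulAction.exists_smul_eq H y y₀
  obtain ⟨χ, hχ⟩ := S.exists_infl_eq_charTranslate y₀
    (fun a ha => S.eq_one_of_mem_weightSpace hf hb a ha) hh
  obtain ⟨θ, ⟨hθ, k, hk⟩, -⟩ := hΘ χ⁻¹
  refine ⟨k.1⁻¹ * h, θ, hθ, ?_⟩
  have h1 := (S.baseTranslate_eq_iff y₀ _ _ _).1 hk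
  rw [charTranslate_mul, ← hχ, eq_comm, charTranslate_inv_eq_iff]
  show charTranslate k.1 (S.infl y₀ θ⁻¹) = _
  rw [infl_inv, charTranslate_inv, h1, infl_inv, inv_inv]

lemma infl_inv_apply_neg (θ : AddChar (B y₀) Circle) (a : A) :
    S.infl y₀ θ⁻¹ (-a) = S.infl y₀ θ a := by
  simp [infl_apply]

lemma mem_Hst_of_charTranslate_inv {θ : AddChar (B y₀) Circle} (h : H)
    (hh : charTranslate h (S.infl y₀ θ⁻¹) = S.infl y₀ θ⁻¹) : h ∈ S.Hst y₀ θ := by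
  rw [infl_inv, charTranslate_inv, inv_inj] at hh
  exact hh

/-- Evaluation of a function on `X` at the points `(y, 0)`, as a map from the vectors of weight
`θ̄ ∘ π` to the functions on the fibre of `θ`. -/
def evalZero (θ : AddChar (B y₀) Circle) :
    IntertwiningMap (weightRep (permRep (SemiProd H A) S.Space) (S.infl y₀ θ⁻¹) (S.Hst y₀ θ)
      (S.charTranslate_infl_inv y₀ θ)) (permRep (S.Hst y₀ θ) (S.fibre y₀ θ)) where
  toFun f y := f.1 (S.pt y.1 0)
  map_add' _ _ := rfl
  map_smul' _ _ := rfl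
  isIntertwining' t := by
    refine LinearMap.ext fun f => funext fun y => ?_
    show f.1 ((ofH t.1)⁻¹ • S.pt y.1 0) = f.1 (S.pt (t.1⁻¹ • y.1) 0)
    rw [← ofH_inv, ofH_smul_pt, map_zero]

/-- A function `f` of weight `θ̄ ∘ π` satisfies `f(y, π_y(a)) = θ(π(a)) f(y, 0)`, and so vanishes above
`y` unless `θ ∘ π` is trivial on the kernel of `π_y`. -/
lemma evalZero_bijective (θ : AddChar (B y₀) Circle) :
    Function.Bijective (S.evalZero y₀ θ) := by
  classical
  constructor
  · rw [injective_iff_map_eq_zero]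
    intro f hf
    refine Subtype.ext (funext fun x => ?_)
    obtain ⟨y, b⟩ := x
    by_contra hb
    have hy : y ∈ S.fibre y₀ θ := fun a ha => by
      have h1 := S.eq_one_of_mem_weightSpace f.2 hb (-a) (by rw [map_neg, ha, neg_zero])
      rwa [infl_inv_apply_neg] at h1
    obtain ⟨a, rfl⟩ := S.π_surjective y b
    have h1 := S.mem_weightSpace_permRep.1 f.2 y a 0
    rw [add_zero, show f.1 (S.pt y 0) = 0 from congrFun hf ⟨y, hy⟩, mul_zero] at h1
    exact hb h1
  · intro c
    have hs := fun y => Function.surjInv_eq (S.π_surjective y)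
    let f : S.Space → ℂ := fun x => if hy : x.1 ∈ S.fibre y₀ θ then
      (S.infl y₀ θ (Function.surjInv (S.π_surjective x.1) x.2) : ℂ) * c ⟨x.1, hy⟩ else 0
    have hw : ∀ y ∈ S.fibre y₀ θ, ∀ a a', S.π y a = S.π y a' →
        S.infl y₀ θ a = S.infl y₀ θ a' := by
      intro y hy a a' haa
      have h1 := hy (a - a') (by rw [map_sub, haa, sub_self])
      rwa [AddChar.map_sub_eq_div, div_eq_one] at h1
    have hf : f ∈ weightSpace (permRep (SemiProd H A) S.Space) (S.infl y₀ θ⁻¹) := by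
      rw [mem_weightSpace_permRep]
      intro y a b
      by_cases hy : y ∈ S.fibre y₀ θ
      · rw [show f (S.pt y b) = _ from dif_pos hy,
          show f (S.pt y (S.π y a + b)) = _ from dif_pos hy, infl_inv_apply_neg, ← mul_assoc,
          ← Circle.coe_mul, ← AddChar.map_add_eq_mul]
        congr 2
        exact hw y hy _ _ (by rw [map_add]; exact (hs y _).trans (congrArg _ (hs y _).symm))
      · rw [show f (S.pt y b) = _ from dif_neg hy,
          show f (S.pt y (S.π y a + b)) = _ from dif_neg hy, mul_zero]
    refine ⟨⟨f, hf⟩, funext fun y => ?_⟩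
    have h1 := hw y.1 y.2 (Function.surjInv (S.π_surjective y.1) 0) 0
      ((hs y.1 0).trans (map_zero _).symm)
    refine (dif_pos y.2).trans ?_
    show (S.infl y₀ θ (Function.surjInv (S.π_surjective y.1) 0) : ℂ) * c y = c y
    rw [h1, AddChar.map_zero_eq_one, Circle.coe_one, one_mul]

/-- The `H_θ`-representation on the vectors of weight `θ̄ ∘ π` in `L(X)` is the permutation
representation on the fibre of `θ`. -/
def weightRepEquiv (θ : AddChar (B y₀) Circle) :
    (weightRep (permRep (SemiProd H A) S.Space) (S.infl y₀ θ⁻¹) (S.Hst y₀ θ)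
      (S.charTranslate_infl_inv y₀ θ)).Equiv (permRep (S.Hst y₀ θ) (S.fibre y₀ θ)) :=
  (S.evalZero y₀ θ).ofBijective (S.evalZero_bijective y₀ θ)

/-- When `H_θ` is transitive on the fibre of `θ`, that fibre is `H_θ/K_θ`. -/
def quotientFibreEquiv (θ : AddChar (B y₀) Circle)
    [MulAction.IsPretransitive (S.Hst y₀ θ) (S.fibre y₀ θ)] :
    (permRep (S.Hst y₀ θ) (S.Hst y₀ θ ⧸ S.Kst y₀ θ)).Equiv
      (permRep (S.Hst y₀ θ) (S.fibre y₀ θ)) :=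
  permRepQuotientEquiv _ (S.stabilizer_fibre y₀ θ)

/-! ### The criterion -/

lemma isPretransitive_space [MulAction.IsPretransitive H Y] :
    MulAction.IsPretransitive (SemiProd H A) S.Space := by
  obtain h | ⟨⟨y₀⟩⟩ := isEmpty_or_nonempty Y
  · exact ⟨fun x => (h.false x.1).elim⟩
  rw [MulAction.isPretransitive_iff_base (S.pt y₀ 0)]
  rintro ⟨y, b⟩
  obtain ⟨h, rfl⟩ := MulAction.exists_smul_eq H y₀ y
  obtain ⟨a, rfl⟩ := S.π_surjective _ b
  refine ⟨ofA a * ofH h, ?_⟩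
  rw [mul_smul, ofH_smul_pt, ofA_smul_pt, map_zero, add_zero]
  rfl

lemma stabilizer_pt : MulAction.stabilizer (SemiProd H A) (S.pt y₀ 0) = S.KC y₀ := by
  ext g
  rw [MulAction.mem_stabilizer_iff, smul_pt, map_zero, add_zero]
  have key : ∀ (z : Y), S.pt z (S.π z g.left.toAdd) = S.pt y₀ 0 ↔
      z = y₀ ∧ S.π y₀ g.left.toAdd = 0 := by
    intro z
    constructor
    · intro h
      obtain rfl : z = y₀ := congrArg Sigma.fst h
      exact ⟨rfl, eq_of_heq (Sigma.mk.inj h).2⟩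
    · rintro ⟨rfl, h⟩
      rw [h]
  exact key _

/-- `L((H ⋉ A)/(K ⋉ C))` and `L(X)` are equivalent. -/
def quotientKCEquiv [MulAction.IsPretransitive H Y] :
    (permRep (SemiProd H A) (SemiProd H A ⧸ S.KC y₀)).Equiv (permRep (SemiProd H A) S.Space) :=
  haveI := S.isPretransitive_space
  permRepQuotientEquiv _ (S.stabilizer_pt y₀)

lemma finite_space [Finite H] [Finite A] [MulAction.IsPretransitive H Y] : Finite S.Space := by
  obtain h | ⟨⟨y₀⟩⟩ := isEmpty_or_nonempty Y
  · exact @Finite.of_subsingleton _ ⟨fun x => (h.false x.1).elim⟩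
  have : Finite Y := Finite.of_surjective _ (MulAction.surjective_smul H y₀)
  have : ∀ y, Finite (B y) := fun y => Finite.of_surjective _ (S.π_surjective y)
  exact inferInstanceAs (Finite (Σ y, B y))

/-- If the commutant of `L(X)` is commutative, then so are those of its weight spaces, which are the
permutation representations on the fibres, and the fibres are transitive. Conversely, transitive
fibres are the `H_θ/K_θ`, and the weights `θ̄ ∘ π` with `θ ∈ Θ` meet every orbit of weights. -/
theorem hasCommutingEnd_iff [Finite H] [Finite A] [MulAction.IsPretransitive H Y]
    {Θ : Set (AddChar (B y₀) Circle)} (hΘ : S.IsKRepresentatives y₀ Θ) :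
    HasCommutingEnd (permRep (SemiProd H A) S.Space) ↔
      S.OrbitCondition y₀ ∧
        ∀ θ ∈ Θ, HasCommutingEnd (permRep (S.Hst y₀ θ) (S.Hst y₀ θ ⧸ S.Kst y₀ θ)) := by
  constructor
  · intro h
    have : Finite Y := Finite.of_surjective _ (MulAction.surjective_smul H y₀)
    have hfib : ∀ θ, HasCommutingEnd (permRep (S.Hst y₀ θ) (S.fibre y₀ θ)) := fun θ =>
      (h.on_weightSpace _ (S.charTranslate_infl_inv y₀ θ)
        (S.mem_Hst_of_charTranslate_inv y₀)).of_equiv (S.weightRepEquiv y₀ θ)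
    have : ∀ θ, Finite (S.fibre y₀ θ) := fun θ => Subtype.finite
    have htrans := fun θ =>
      isPretransitive_of_hasCommutingEnd ⟨y₀, S.base_mem_fibre y₀ θ⟩ (hfib θ)
    exact ⟨S.orbitCondition_of_isPretransitive y₀ hΘ fun θ _ => htrans θ,
      fun θ _ => (hfib θ).of_equiv (S.quotientFibreEquiv y₀ θ).symm⟩
  · rintro ⟨hcond, hGelfand⟩
    refine hasCommutingEnd_of_weightRep _ (S.exists_charTranslate_mem y₀ hΘ) ?_
    rintro _ ⟨θ, hθ, rfl⟩
    have := hcond.isPretransitive_fibre θ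
    exact ⟨_, S.charTranslate_infl_inv y₀ θ, (hGelfand θ hθ).of_equiv
      ((S.quotientFibreEquiv y₀ θ).trans (S.weightRepEquiv y₀ θ).symm)⟩

end SemidirectSystem

/-! ### Induced representations -/

section Induced

open Representation

variable {G U V : Type*} [Group G] [AddCommGroup U] [Module ℂ U] [AddCommGroup V] [Module ℂ V]
  {K : Subgroup G} {σ : Representation ℂ K U}

@[simp]
lemma indRep_apply_coe (g x : G) (f : indSpace σ) : (indRep σ g f).1 x = f.1 (g⁻¹ * x) := rfl

open Classical in
/-- The function supported on `K` with value `u` at `1`. -/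
def indDelta (σ : Representation ℂ K U) : U →ₗ[ℂ] indSpace σ where
  toFun u := ⟨fun g => if hg : g ∈ K then σ ⟨g, hg⟩⁻¹ u else 0, fun g k => by
    beta_reduce
    by_cases hg : g ∈ K
    · rw [dif_pos hg, dif_pos (K.mul_mem hg k.2), ← Module.End.mul_apply, ← map_mul,
        ← mul_inv_rev]
      rfl
    · rw [dif_neg hg, dif_neg (fun h => hg ((K.mul_mem_cancel_right k.2).1 h)), map_zero]⟩
  map_add' u v := by
    ext g
    by_cases hg : g ∈ K <;> simp [hg]
  map_smul' c u := by
    ext g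
    by_cases hg : g ∈ K <;> simp [hg]

lemma indDelta_of_mem (u : U) {g : G} (hg : g ∈ K) :
    (indDelta σ u).1 g = σ ⟨g, hg⟩⁻¹ u := dif_pos hg

lemma indDelta_of_notMem (u : U) {g : G} (hg : g ∉ K) : (indDelta σ u).1 g = 0 := dif_neg hg

lemma indDelta_one (u : U) : (indDelta σ u).1 1 = u := by
  rw [indDelta_of_mem u K.one_mem, show (⟨1, K.one_mem⟩ : K)⁻¹ = 1 from inv_one, map_one]
  rfl

lemma indSpace_apply_mul (f : indSpace σ) (g : G) {k : G} (hk : k ∈ K) :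
    f.1 (g * k) = σ ⟨k, hk⟩⁻¹ (f.1 g) := f.2 g ⟨k, hk⟩

/-- A function supported on `K` is determined by its value at `1`. -/
lemma eq_indDelta {f : indSpace σ} (hf : ∀ g, g ∉ K → f.1 g = 0) : f = indDelta σ (f.1 1) := by
  refine Subtype.ext (funext fun g => ?_)
  by_cases hg : g ∈ K
  · rw [indDelta_of_mem _ hg, ← indSpace_apply_mul f 1 hg, one_mul]
  · rw [indDelta_of_notMem _ hg, hf g hg]

lemma indRep_indDelta (k : K) (u : U) :
    indRep σ (k : G) (indDelta σ u) = indDelta σ (σ k u) := by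
  have h1 : (indRep σ (k : G) (indDelta σ u)).1 1 = σ k u := by
    rw [indRep_apply_coe, mul_one, indDelta_of_mem _ (K.inv_mem k.2)]
    exact congrArg (fun k' => σ k' u) (inv_inv k)
  rw [← h1]
  refine eq_indDelta fun g hg => ?_
  rw [indRep_apply_coe, indDelta_of_notMem]
  exact fun h => hg ((K.mul_mem_cancel_left (K.inv_mem k.2)).1 h)

variable [Fintype G]

/-- The functions supported on `K` generate the induced representation. -/
lemma sum_indRep_indDelta (f : indSpace σ) :
    ∑ g : G, indRep σ g (indDelta σ (f.1 g)) = (Nat.card K : ℂ) • f := by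
  classical
  refine Subtype.ext (funext fun x => ?_)
  have key : ∀ k : G, (indDelta σ (f.1 (x * k⁻¹))).1 k = if k ∈ K then f.1 x else 0 := by
    intro k
    split_ifs with hk
    · rw [indDelta_of_mem _ hk, indSpace_apply_mul f x (K.inv_mem hk), ← Module.End.mul_apply,
        ← map_mul]
      have : (⟨k, hk⟩ : K)⁻¹ * (⟨k⁻¹, K.inv_mem hk⟩ : K)⁻¹ = 1 := by
        ext
        simp
      rw [this, map_one]
      rfl
    · rw [indDelta_of_notMem _ hk]
  calc (∑ g : G, indRep σ g (indDelta σ (f.1 g))).1 x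
      = ∑ g : G, (indDelta σ (f.1 g)).1 (g⁻¹ * x) := by
        rw [AddSubmonoidClass.coe_finsetSum, Finset.sum_apply]
        rfl
    _ = ∑ k : G, (indDelta σ (f.1 (x * k⁻¹))).1 k := by
        refine Fintype.sum_equiv ((Equiv.inv G).trans (Equiv.mulRight x)) _ _ fun g => ?_
        simp
    _ = ((Nat.card K : ℂ) • f).1 x := by
        rw [Finset.sum_congr rfl fun k _ => key k, Finset.sum_ite, Finset.sum_const_zero,
          add_zero, Finset.sum_const, ← Nat.cast_smul_eq_nsmul ℂ, Nat.card_eq_fintype_card,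
          Fintype.card_subtype]
        rfl

/-- Frobenius reciprocity: a `K`-map `φ` from `σ` to a representation of `G` extends to the
induced representation as `f ↦ |K|⁻¹ ∑ g, ρ(g) φ(f(g))`. -/
def indLift (ρ : Representation ℂ G V) (σ : Representation ℂ K U) (φ : U →ₗ[ℂ] V) :
    IntertwiningMap (indRep σ) ρ where
  toLinearMap := (Nat.card K : ℂ)⁻¹ • ∑ g : G, ρ g ∘ₗ φ ∘ₗ LinearMap.proj g ∘ₗ
    (indSpace σ).subtype
  isIntertwining' g := by
    refine LinearMap.ext fun f => ?_
    simp only [LinearMap.comp_apply, LinearMap.smul_apply, LinearMap.sum_apply, map_smul, map_sum,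
      LinearMap.proj_apply, Submodule.subtype_apply]
    congr 1
    refine Fintype.sum_equiv (Equiv.mulLeft g⁻¹) _ _ fun h => ?_
    rw [Equiv.coe_mulLeft, indRep_apply_coe, ← Module.End.mul_apply (ρ g), ← map_mul,
      mul_inv_cancel_left]

lemma indLift_apply (ρ : Representation ℂ G V) (φ : U →ₗ[ℂ] V) (f : indSpace σ) :
    indLift ρ σ φ f = (Nat.card K : ℂ)⁻¹ • ∑ g : G, ρ g (φ (f.1 g)) := by
  show ((Nat.card K : ℂ)⁻¹ • ∑ g : G, ρ g ∘ₗ φ ∘ₗ LinearMap.proj g ∘ₗ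
    (indSpace σ).subtype) f = _
  simp only [LinearMap.comp_apply, LinearMap.smul_apply, LinearMap.sum_apply,
    LinearMap.proj_apply, Submodule.subtype_apply]

lemma indLift_indDelta (ρ : Representation ℂ G V) {φ : U →ₗ[ℂ] V}
    (hφ : ∀ (k : K) u, φ (σ k u) = ρ k (φ u)) (u : U) :
    indLift ρ σ φ (indDelta σ u) = φ u := by
  classical
  have key : ∀ g : G, ρ g (φ ((indDelta σ u).1 g)) = if g ∈ K then φ u else 0 := by
    intro g
    split_ifs with hg
    · rw [indDelta_of_mem _ hg, hφ, ← Module.End.mul_apply, ← map_mul]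
      show ρ (g * g⁻¹) (φ u) = φ u
      rw [mul_inv_cancel, map_one]
      rfl
    · rw [indDelta_of_notMem _ hg, map_zero, map_zero]
  rw [indLift_apply, Finset.sum_congr rfl fun g _ => key g, Finset.sum_ite,
    Finset.sum_const_zero, add_zero, Finset.sum_const, ← Nat.cast_smul_eq_nsmul ℂ, smul_smul,
    Nat.card_eq_fintype_card, Fintype.card_subtype, inv_mul_cancel₀, one_smul]
  rw [← Fintype.card_subtype]
  exact Nat.cast_ne_zero.2 (Fintype.card_ne_zero (α := K))

/-- The value of a function in the space of the induced representation at representatives of the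
cosets of `K`. -/
def indSpaceToFun (σ : Representation ℂ K U) : indSpace σ →ₗ[ℂ] (G ⧸ K → U) where
  toFun f q := f.1 q.out
  map_add' _ _ := rfl
  map_smul' _ _ := rfl

lemma indSpaceToFun_bijective (σ : Representation ℂ K U) :
    Function.Bijective (indSpaceToFun σ) := by
  classical
  constructor
  · rw [injective_iff_map_eq_zero]
    intro f hf
    refine Subtype.ext (funext fun g => ?_)
    have hg : (QuotientGroup.mk g : G ⧸ K).out⁻¹ * g ∈ K :=
      QuotientGroup.eq.1 (QuotientGroup.out_eq' _)
    have h1 := indSpace_apply_mul f (QuotientGroup.mk g : G ⧸ K).out hg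
    rwa [mul_inv_cancel_left, show f.1 (QuotientGroup.mk g : G ⧸ K).out = 0 from congrFun hf _,
      map_zero] at h1
  · intro c
    refine ⟨∑ q : G ⧸ K, indRep σ q.out (indDelta σ (c q)), funext fun q => ?_⟩
    show (∑ q : G ⧸ K, indRep σ q.out (indDelta σ (c q))).1 q.out = c q
    rw [AddSubmonoidClass.coe_finsetSum, Finset.sum_apply, Finset.sum_eq_single q]
    · rw [indRep_apply_coe, inv_mul_cancel, indDelta_one]
    · intro q' _ hq'
      rw [indRep_apply_coe, indDelta_of_notMem]
      intro h
      apply hq'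
      rw [← QuotientGroup.out_eq' q', ← QuotientGroup.out_eq' q]
      exact QuotientGroup.eq.2 h
    · simp

lemma finrank_indSpace (σ : Representation ℂ K U) [FiniteDimensional ℂ U] :
    Module.finrank ℂ (indSpace σ) = K.index * Module.finrank ℂ U := by
  classical
  rw [(LinearEquiv.ofBijective _ (indSpaceToFun_bijective σ)).finrank_eq, Subgroup.index,
    Nat.card_eq_fintype_card]
  simp [Module.finrank_pi_fintype]

end Induced

/-! ### Representations of `H ⋉ A` induced from stabilizers of characters -/

section LittleGroup

open Representation SemiProd

variable {H A U U' V : Type*} [Group H] [AddCommGroup A] [DistribMulAction H A]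
  [AddCommGroup U] [Module ℂ U] [AddCommGroup U'] [Module ℂ U'] [AddCommGroup V] [Module ℂ V]

lemma ofA_mul_eq (a : A) (g : SemiProd H A) : ofA a * g = g * ofA (g.right⁻¹ • a) := by
  have key : ∀ (x : A) (h : H), (ofA a * (ofA x * ofH h) : SemiProd H A) =
      ofA x * ofH h * ofA (h⁻¹ • a) := fun x h => by
    rw [mul_assoc _ (ofH _), ofH_mul_ofA, ← mul_assoc, ← mul_assoc, ← ofA_add, ← ofA_add,
      add_comm, smul_inv_smul]
  have h1 := key g.left.toAdd g.right
  rwa [← eq_ofA_mul_ofH] at h1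

lemma ofA_mem_overA (T : Subgroup H) (a : A) : ofA a ∈ overA (A := A) T := T.one_mem

lemma ofH_mem_overA {T : Subgroup H} {t : H} (ht : t ∈ T) : ofH t ∈ overA (A := A) T := ht

variable {T T' : Subgroup H} {ψ ψ' χ : AddChar A Circle} {hT : ∀ h ∈ T, charTranslate h ψ = ψ}
  {hT' : ∀ h ∈ T', charTranslate h ψ' = ψ'}
  {σ : Representation ℂ T U} {σ' : Representation ℂ T U'} {τ : Representation ℂ T' U'}

lemma extTensorInfl_apply (g : overA (A := A) T) (u : U) :
    extTensorInfl T ψ hT σ g u = (ψ g.1.left.toAdd : ℂ) • σ ⟨g.1.right, g.2⟩ u := rfl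

lemma extTensorInfl_ofA (a : A) (u : U) :
    extTensorInfl T ψ hT σ ⟨ofA a, ofA_mem_overA T a⟩ u = (ψ a : ℂ) • u := by
  rw [extTensorInfl_apply]
  show (ψ a : ℂ) • σ 1 u = _
  rw [map_one]
  rfl

lemma extTensorInfl_ofH (t : T) (u : U) :
    extTensorInfl T ψ hT σ ⟨ofH t.1, ofH_mem_overA t.2⟩ u = σ t u := by
  rw [extTensorInfl_apply]
  show (ψ 0 : ℂ) • σ t u = _
  rw [AddChar.map_zero_eq_one, Circle.coe_one, one_smul]

/-- A function in the induced representation has weight `ʰψ` on the coset of `(h, a)`. -/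
lemma indRep_ofA_apply (f : indSpace (extTensorInfl T ψ hT σ)) (a : A) (g : SemiProd H A) :
    (indRep (extTensorInfl T ψ hT σ) (ofA a) f).1 g = (ψ (g.right⁻¹ • a) : ℂ) • f.1 g := by
  rw [indRep_apply_coe, ← ofA_neg, ofA_mul_eq, indSpace_apply_mul f g (ofA_mem_overA T _),
    smul_neg]
  have h1 : (⟨ofA (-(g.right⁻¹ • a)), ofA_mem_overA T _⟩ : overA (A := A) T)⁻¹ =
      ⟨ofA (g.right⁻¹ • a), ofA_mem_overA T _⟩ := Subtype.ext (by
    rw [Subgroup.coe_inv, ← ofA_neg, neg_neg])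
  rw [h1, extTensorInfl_ofA]

lemma charTranslate_eq_of_mem_weightSpace {f : indSpace (extTensorInfl T ψ hT σ)}
    (hf : f ∈ weightSpace (indRep (extTensorInfl T ψ hT σ)) χ) {g : SemiProd H A}
    (hg : f.1 g ≠ 0) : charTranslate g.right ψ = χ := by
  ext a
  have h1 := indRep_ofA_apply f a g
  rw [hf a] at h1
  exact (smul_left_injective ℂ hg h1).symm

lemma indDelta_mem_weightSpace (u : U) :
    indDelta (extTensorInfl T ψ hT σ) u ∈ weightSpace (indRep (extTensorInfl T ψ hT σ)) ψ := by
  intro a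
  have h1 := indRep_indDelta (σ := extTensorInfl T ψ hT σ) ⟨ofA a, ofA_mem_overA T a⟩ u
  rwa [extTensorInfl_ofA, map_smul] at h1

lemma eq_indDelta_of_mem_weightSpace (hfull : ∀ h, charTranslate h ψ = ψ → h ∈ T)
    {f : indSpace (extTensorInfl T ψ hT σ)}
    (hf : f ∈ weightSpace (indRep (extTensorInfl T ψ hT σ)) ψ) :
    f = indDelta (extTensorInfl T ψ hT σ) (f.1 1) := by
  refine eq_indDelta fun g hg => ?_
  by_contra h
  exact hg (hfull _ (charTranslate_eq_of_mem_weightSpace hf h))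

lemma indDelta_ne_zero {u : U} (hu : u ≠ 0) : indDelta (extTensorInfl T ψ hT σ) u ≠ 0 := by
  intro h
  apply hu
  rw [← indDelta_one (σ := extTensorInfl T ψ hT σ) u, h]
  rfl

/-- Equivalent induced representations have characters in the same `H`-orbit. -/
lemma exists_charTranslate_of_equiv [Nontrivial U]
    (e : (indRep (extTensorInfl T ψ hT σ)).Equiv (indRep (extTensorInfl T' ψ' hT' τ))) :
    ∃ h : H, charTranslate h ψ' = ψ := by
  obtain ⟨u, hu⟩ := exists_ne (0 : U)
  have h0 : e (indDelta _ u) ≠ 0 := fun h =>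
    indDelta_ne_zero hu ((EmbeddingLike.map_eq_zero_iff (f := e)).1 h)
  obtain ⟨g, hg⟩ : ∃ g, (e (indDelta _ u)).1 g ≠ 0 := by
    by_contra! h
    exact h0 (Subtype.ext (funext h))
  exact ⟨g.right, charTranslate_eq_of_mem_weightSpace
    (map_mem_weightSpace e.toIntertwiningMap (indDelta_mem_weightSpace u)) hg⟩

/-- Equivalent representations induced from the same stabilizer come from equivalent
representations of the stabilizer: compare the vectors of weight `ψ`. -/
lemma nonempty_equiv_of_indRep_equiv (hfull : ∀ h, charTranslate h ψ = ψ → h ∈ T)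
    (hσ : σ.IsIrreducible) (hσ' : σ'.IsIrreducible)
    (e : (indRep (extTensorInfl T ψ hT σ)).Equiv (indRep (extTensorInfl T ψ hT σ'))) :
    Nonempty (σ.Equiv σ') := by
  have hδ : ∀ u, e (indDelta _ u) = indDelta _ ((e (indDelta _ u)).1 1) := fun u =>
    eq_indDelta_of_mem_weightSpace hfull
      (map_mem_weightSpace e.toIntertwiningMap (indDelta_mem_weightSpace u))
  let φ : IntertwiningMap σ σ' :=
    { toFun := fun u => (e (indDelta _ u)).1 1
      map_add' := fun u v => by rw [map_add, map_add]; rfl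
      map_smul' := fun c u => by rw [map_smul, map_smul]; rfl
      isIntertwining' := fun t => by
        refine LinearMap.ext fun u => ?_
        show (e (indDelta _ (σ t u))).1 1 = σ' t ((e (indDelta _ u)).1 1)
        rw [← extTensorInfl_ofH (hT := hT) (σ := σ), ← indRep_indDelta]
        have h1 := e.toIntertwiningMap.isIntertwining _ _ (ofH t.1) (indDelta _ u)
        rw [Equiv.coe_toIntertwiningMap] at h1
        rw [h1, hδ u]
        have h2 := indRep_indDelta (σ := extTensorInfl T ψ hT σ') ⟨ofH t.1, ofH_mem_overA t.2⟩
          ((e (indDelta _ u)).1 1)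
        rw [h2, indDelta_one, indDelta_one, extTensorInfl_ofH] }
  rcases IsIrreducible.bijective_or_eq_zero φ with h | h
  · exact ⟨φ.ofBijective h⟩
  · exfalso
    obtain ⟨u, hu⟩ := @exists_ne _ hσ.nontrivial (0 : U)
    have h1 : (e (indDelta _ u)).1 1 = 0 := by
      show φ u = 0
      rw [h]
      rfl
    have h2 := hδ u
    rw [h1, map_zero] at h2
    exact indDelta_ne_zero hu ((EmbeddingLike.map_eq_zero_iff (f := e)).1 h2)

variable [Finite H] [Finite A]

/-- The vectors of weight `ψ` in a subrepresentation form a subrepresentation of `σ`, which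
determines it. -/
theorem isIrreducible_indRep (hfull : ∀ h, charTranslate h ψ = ψ → h ∈ T) (hσ : σ.IsIrreducible) :
    (indRep (extTensorInfl T ψ hT σ)).IsIrreducible := by
  have : Finite (SemiProd H A) := Finite.of_equiv _ SemidirectProduct.equivProd.symm
  cases nonempty_fintype (SemiProd H A)
  cases nonempty_fintype A
  obtain ⟨u, hu⟩ := @exists_ne _ hσ.nontrivial (0 : U)
  refine { exists_pair_ne := ⟨⊥, ⊤, fun hbt => ?_⟩, eq_bot_or_eq_top := fun N => ?_ }
  · have hmem : indDelta (extTensorInfl T ψ hT σ) u ∈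
        (⊤ : Subrepresentation (indRep (extTensorInfl T ψ hT σ))) := Submodule.mem_top
    rw [← hbt] at hmem
    exact indDelta_ne_zero hu hmem
  · let M : Subrepresentation σ :=
      { toSubmodule := N.toSubmodule.comap (indDelta (extTensorInfl T ψ hT σ))
        apply_mem_toSubmodule := fun t w hw => by
          have h1 := N.apply_mem_toSubmodule (ofH t.1) hw
          have h2 := indRep_indDelta (σ := extTensorInfl T ψ hT σ)
            ⟨ofH t.1, ofH_mem_overA t.2⟩ w
          rw [extTensorInfl_ofH] at h2
          rwa [h2] at h1 }
    rcases hσ.eq_bot_or_eq_top M with hM | hM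
    · left
      refine le_bot_iff.1 fun f hf => ?_
      -- Translate `f` to bring `f g` to `1`, then project to weight `ψ`, which keeps that value.
      refine Subtype.ext (funext fun g => ?_)
      set f' := indRep (extTensorInfl T ψ hT σ) g⁻¹ f with hf'
      have hfN : f' ∈ N.toSubmodule := N.apply_mem_toSubmodule g⁻¹ hf
      have hp : weightProj (indRep (extTensorInfl T ψ hT σ)) ψ f' ∈ N.toSubmodule := by
        rw [weightProj_apply]
        exact N.toSubmodule.smul_mem _ (Submodule.sum_mem _ fun a _ =>
          N.toSubmodule.smul_mem _ (N.apply_mem_toSubmodule _ hfN))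
      have hp1 : (weightProj (indRep (extTensorInfl T ψ hT σ)) ψ f').1 1 = f'.1 1 := by
        have h1 : ∀ a : A, ((ψ (-a) : ℂ) • indRep (extTensorInfl T ψ hT σ) (ofA a) f').1 1 =
            f'.1 1 := fun a => by
          show (ψ (-a) : ℂ) • (indRep (extTensorInfl T ψ hT σ) (ofA a) f').1 1 = _
          rw [indRep_ofA_apply]
          show (ψ (-a) : ℂ) • (ψ ((1 : H)⁻¹ • a) : ℂ) • f'.1 1 = _
          rw [inv_one, one_smul, smul_smul, ← Circle.coe_mul, ← AddChar.map_add_eq_mul,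
            neg_add_cancel, AddChar.map_zero_eq_one, Circle.coe_one, one_smul]
        rw [weightProj_apply]
        show (Fintype.card A : ℂ)⁻¹ • (∑ a : A, (ψ (-a) : ℂ) •
          indRep (extTensorInfl T ψ hT σ) (ofA a) f').1 1 = _
        rw [AddSubmonoidClass.coe_finsetSum, Finset.sum_apply, Finset.sum_congr rfl fun a _ => h1 a,
          Finset.sum_const, Finset.card_univ, ← Nat.cast_smul_eq_nsmul ℂ, smul_smul,
          inv_mul_cancel₀ (by simp), one_smul]
      rw [eq_indDelta_of_mem_weightSpace hfull (weightProj_mem ψ f'), hp1] at hp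
      have h2 : f'.1 1 ∈ M := hp
      rw [hM] at h2
      have h3 : f'.1 1 = 0 := h2
      rwa [hf', indRep_apply_coe, inv_inv, mul_one] at h3
    · right
      refine top_le_iff.1 fun f _ => ?_
      have hδ : ∀ w, indDelta (extTensorInfl T ψ hT σ) w ∈ N.toSubmodule := fun w => by
        have h1 : w ∈ M := by rw [hM]; exact Submodule.mem_top
        exact h1
      have h1 := Submodule.sum_mem N.toSubmodule (t := Finset.univ)
        (f := fun g : SemiProd H A => indRep (extTensorInfl T ψ hT σ) g (indDelta _ (f.1 g)))
        fun g _ => N.apply_mem_toSubmodule g (hδ (f.1 g))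
      rw [sum_indRep_indDelta] at h1
      exact (N.toSubmodule.smul_mem_iff (Nat.cast_ne_zero.2 Nat.card_pos.ne')).1 h1

variable {ρ : Representation ℂ (SemiProd H A) V}

/-- The extension to the induced representation of a map from `σ` to the vectors of weight `ψ`. -/
lemma exists_indRep_map (φ : IntertwiningMap σ (weightRep ρ ψ T hT)) :
    ∃ F : IntertwiningMap (indRep (extTensorInfl T ψ hT σ)) ρ,
      ∀ u, F (indDelta _ u) = φ u := by
  have : Finite (SemiProd H A) := Finite.of_equiv _ SemidirectProduct.equivProd.symm
  cases nonempty_fintype (SemiProd H A)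
  refine ⟨indLift ρ _ ((weightSpace ρ ψ).subtype ∘ₗ φ.toLinearMap), fun u =>
    indLift_indDelta ρ (fun k u => ?_) u⟩
  rw [extTensorInfl_apply, map_smul]
  show (ψ k.1.left.toAdd : ℂ) • (φ (σ ⟨k.1.right, k.2⟩ u) : V) = ρ k (φ u)
  have h1 := ofH_apply_mem_weightSpace (φ u).2 k.1.right
  rw [hT k.1.right k.2] at h1
  have h2 : ρ k (φ u : V) = ρ (ofA k.1.left.toAdd) (ρ (ofH k.1.right) (φ u : V)) := by
    conv_lhs => rw [eq_ofA_mul_ofH k.1]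
    rw [map_mul, Module.End.mul_apply]
  rw [h2, h1, IntertwiningMap.isIntertwining]
  rfl

end LittleGroup

/-! ### The decomposition of `L(X)` -/

namespace SemidirectSystem

open Representation SemiProd

variable {H A Y : Type*} {B : Y → Type*} [Group H] [AddCommGroup A]
  [DistribMulAction H A] [MulAction H Y] [∀ y, AddCommGroup (B y)]
  (S : SemidirectSystem H A Y B) (y₀ : Y)

lemma index_overA (T : Subgroup H) : (overA (A := A) T).index = T.index :=
  Subgroup.index_comap_of_surjective T SemidirectProduct.rightHom_surjective

lemma finrank_wignerRep [Finite H] [Finite A] (θ : AddChar (B y₀) Circle) {U : Type*}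
    [AddCommGroup U] [Module ℂ U] [FiniteDimensional ℂ U]
    (σ : Representation ℂ (S.Hst y₀ θ) U) :
    (Module.finrank ℂ (indSpace (extTensorInfl (S.Hst y₀ θ) (S.infl y₀ θ⁻¹)
        (S.charTranslate_infl_inv y₀ θ) σ)) : ℚ) =
      (Nat.card H : ℚ) * (Module.finrank ℂ U : ℚ) / (Nat.card (S.Hst y₀ θ) : ℚ) := by
  have : Finite (SemiProd H A) := Finite.of_equiv _ SemidirectProduct.equivProd.symm
  cases nonempty_fintype (SemiProd H A)
  have h0 : (Nat.card (S.Hst y₀ θ) : ℚ) ≠ 0 := Nat.cast_ne_zero.2 Nat.card_pos.ne'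
  rw [finrank_indSpace, index_overA, eq_div_iff h0, ← (S.Hst y₀ θ).card_mul_index]
  push_cast
  ring

/-- For distinct pairs `(θ, j)` the induced representations are inequivalent. -/
lemma isEmpty_wignerRep_equiv {Θ : Set (AddChar (B y₀) Circle)}
    (hΘ : S.IsKRepresentatives y₀ Θ) (hcond : S.OrbitCondition y₀)
    {J : Θ → Type*} {U : ∀ θ, J θ → Type*}
    [∀ θ j, AddCommGroup (U θ j)] [∀ θ j, Module ℂ (U θ j)]
    {σ : ∀ (θ : Θ) (j : J θ), Representation ℂ (S.Hst y₀ θ.1) (U θ j)}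
    (hirr : ∀ θ j, (σ θ j).IsIrreducible)
    (hne : ∀ θ i j, i ≠ j → IsEmpty ((σ θ i).Equiv (σ θ j)))
    (x x' : Σ θ : Θ, J θ) (hx : x ≠ x') :
    IsEmpty ((S.wignerRep y₀ x.1.1 (σ x.1 x.2)).Equiv
      (S.wignerRep y₀ x'.1.1 (σ x'.1 x'.2))) := by
  refine ⟨fun e => ?_⟩
  obtain ⟨θ, j⟩ := x
  obtain ⟨θ', j'⟩ := x'
  have := (hirr θ j).nontrivial
  obtain ⟨h, hh⟩ := exists_charTranslate_of_equiv e
  dsimp only at hh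
  rw [infl_inv, infl_inv, charTranslate_inv, inv_inj] at hh
  obtain rfl : θ' = θ := Subtype.ext (hcond.eq_of_charTranslate hΘ θ'.2 θ.2 hh)
  obtain ⟨e'⟩ := nonempty_equiv_of_indRep_equiv (S.mem_Hst_of_charTranslate_inv y₀)
    (hirr θ' j) (hirr θ' j') e
  exact (hne θ' j j' fun hj => hx (by rw [hj])).false e'

section Decomposition

variable {J G : Type*} [Group G] {U : J → Type*} [∀ j, AddCommGroup (U j)]
  [∀ j, Module ℂ (U j)] {V : Type*} [AddCommGroup V] [Module ℂ V] {ρ : Representation ℂ G V}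
  {σ : ∀ j, Representation ℂ G (U j)} {m : J → ℕ}

lemma _root_.IsIrreducibleDecomposition.finiteDimensional [FiniteDimensional ℂ V]
    (h : IsIrreducibleDecomposition ρ σ m) (j : J) : FiniteDimensional ℂ (U j) := by
  classical
  obtain ⟨e⟩ := h.equiv
  let τ : ∀ x : (Σ j, Fin (m j)), Representation ℂ G (U x.1) := fun x => σ x.1
  exact FiniteDimensional.of_injective
    (e.symm.toLinearEquiv.toLinearMap ∘ₗ (directSumIncl τ ⟨j, ⟨0, h.pos j⟩⟩).toLinearMap)
    (e.symm.toLinearEquiv.injective.comp (directSumIncl_injective τ _))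

/-- In the multiplicity-free case all multiplicities are `1`. -/
lemma _root_.IsIrreducibleDecomposition.eq_of_hasCommutingEnd
    (h : IsIrreducibleDecomposition ρ σ m) (hρ : HasCommutingEnd ρ) (j : J) (i : Fin (m j)) :
    i = ⟨0, h.pos j⟩ := by
  classical
  obtain ⟨e⟩ := h.equiv
  by_contra hi
  have := (h.irreducible j).nontrivial
  refine ((hρ.of_equiv e).isEmpty_equiv (i := ⟨j, i⟩) (j := ⟨j, ⟨0, h.pos j⟩⟩) ?_).false
    (Representation.Equiv.refl (σ j))
  intro h'
  exact hi (eq_of_heq (Sigma.mk.inj h').2)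

/-- In the multiplicity-free case the summands embed, and their images span. -/
lemma _root_.IsIrreducibleDecomposition.exists_embeddings
    (h : IsIrreducibleDecomposition ρ σ m) (hρ : HasCommutingEnd ρ) :
    ∃ φ : ∀ j, IntertwiningMap (σ j) ρ, (∀ j, Function.Injective (φ j)) ∧
      ∀ N : Submodule ℂ V, (∀ j u, φ j u ∈ N) → ∀ v, v ∈ N := by
  classical
  obtain ⟨e⟩ := h.equiv
  let τ : ∀ x : (Σ j, Fin (m j)), Representation ℂ G (U x.1) := fun x => σ x.1
  refine ⟨fun j => e.symm.toIntertwiningMap.comp (directSumIncl τ ⟨j, ⟨0, h.pos j⟩⟩),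
    fun j => e.symm.toLinearEquiv.injective.comp (directSumIncl_injective τ _),
    fun N hN v => ?_⟩
  have key : ∀ w, e.symm w ∈ N := fun w => by
    induction w using DirectSum.induction_on with
    | zero => rw [map_zero]; exact N.zero_mem
    | add w w' hw hw' => rw [map_add]; exact N.add_mem hw hw'
    | of x u =>
      obtain ⟨j, i⟩ := x
      obtain rfl := h.eq_of_hasCommutingEnd hρ j i
      exact hN j u
  simpa using key (e v)

end Decomposition

/-- The embeddings of the `σ_{θ,j}` into the weight spaces of `L(X)` extend to the induced
representations, and the extensions add up to an equivalence. -/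
theorem nonempty_equiv_directSum_wignerRep [Finite H] [Finite A] [MulAction.IsPretransitive H Y]
    {Θ : Set (AddChar (B y₀) Circle)}
    (hΘ : S.IsKRepresentatives y₀ Θ) (hcond : S.OrbitCondition y₀)
    (hGelfand : ∀ θ ∈ Θ, HasCommutingEnd (permRep (S.Hst y₀ θ) (S.Hst y₀ θ ⧸ S.Kst y₀ θ)))
    {J : Θ → Type*} {U : ∀ θ, J θ → Type*}
    [∀ θ j, AddCommGroup (U θ j)] [∀ θ j, Module ℂ (U θ j)]
    (σ : ∀ (θ : Θ) (j : J θ), Representation ℂ (S.Hst y₀ θ.1) (U θ j))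
    (m : ∀ θ : Θ, J θ → ℕ)
    (hdec : ∀ θ : Θ, IsIrreducibleDecomposition
        (permRep (S.Hst y₀ θ.1) (S.Hst y₀ θ.1 ⧸ S.Kst y₀ θ.1)) (σ θ) (m θ)) :
    Nonempty ((permRep (SemiProd H A) S.Space).Equiv (Representation.directSum
      (fun x : (Σ θ : Θ, J θ) => S.wignerRep y₀ x.1.1 (σ x.1 x.2)))) := by
  classical
  have : Finite (SemiProd H A) := Finite.of_equiv _ SemidirectProduct.equivProd.symm
  cases nonempty_fintype (SemiProd H A)
  have hfd : ∀ θ j, FiniteDimensional ℂ (U θ j) := fun θ j => (hdec θ).finiteDimensional j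
  have hfd' : ∀ x : (Σ θ : Θ, J θ), FiniteDimensional ℂ (indSpace (extTensorInfl
      (S.Hst y₀ x.1.1) (S.infl y₀ x.1.1⁻¹) (S.charTranslate_infl_inv y₀ x.1.1) (σ x.1 x.2))) :=
    fun x => inferInstance
  have hirr : ∀ x : (Σ θ : Θ, J θ), (S.wignerRep y₀ x.1.1 (σ x.1 x.2)).IsIrreducible := fun x =>
    isIrreducible_indRep (S.mem_Hst_of_charTranslate_inv y₀) ((hdec x.1).irreducible x.2)
  let E : ∀ θ : Θ, (permRep (S.Hst y₀ θ.1) (S.Hst y₀ θ.1 ⧸ S.Kst y₀ θ.1)).Equiv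
      (weightRep (permRep (SemiProd H A) S.Space) (S.infl y₀ θ.1⁻¹) (S.Hst y₀ θ.1)
        (S.charTranslate_infl_inv y₀ θ.1)) := fun θ =>
    haveI := hcond.isPretransitive_fibre θ.1
    (S.quotientFibreEquiv y₀ θ.1).trans (S.weightRepEquiv y₀ θ.1).symm
  choose φ hφ hspan using fun θ : Θ => (hdec θ).exists_embeddings (hGelfand θ.1 θ.2)
  have hF : ∀ x : (Σ θ : Θ, J θ), ∃ F : IntertwiningMap (S.wignerRep y₀ x.1.1 (σ x.1 x.2))
      (permRep (SemiProd H A) S.Space), ∀ u, F (indDelta _ u) = (E x.1 (φ x.1 x.2 u)).1 :=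
    fun x => exists_indRep_map ((E x.1).toIntertwiningMap.comp (φ x.1 x.2))
  choose F hF using hF
  have hFinj : ∀ x, Function.Injective (F x) := by
    intro x
    have := hirr x
    refine (IsIrreducible.injective_or_eq_zero (F x)).resolve_right fun h => ?_
    obtain ⟨u, hu⟩ := @exists_ne _ ((hdec x.1).irreducible x.2).nontrivial (0 : U x.1 x.2)
    have h1 := hF x u
    have h2 : F x (indDelta _ u) = 0 := by rw [h]; rfl
    rw [h2] at h1
    have h3 := (EmbeddingLike.map_eq_zero_iff (f := E x.1)).1 (Subtype.ext h1.symm)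
    exact hu (hφ x.1 x.2 (h3.trans (map_zero _).symm))
  have hinj := directSumLift_injective hirr
    (S.isEmpty_wignerRep_equiv y₀ hΘ hcond (fun θ => (hdec θ).irreducible)
      fun θ => (hdec θ).inequivalent) F hFinj
  -- The image contains the span of the `σ_{θ,j}`, which is the space of vectors of weight `θ̄ ∘ π`.
  have hsurj : Function.Surjective (directSumLift F) := by
    refine eq_top_of_weightSpace_le (directSumLift F).range _ (S.exists_charTranslate_mem y₀ hΘ) ?_
    rintro _ ⟨θ, hθ, rfl⟩ v hv
    have h1 := hspan ⟨θ, hθ⟩ ((directSumLift F).range.toSubmodule.comap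
      ((weightSpace _ _).subtype ∘ₗ (E ⟨θ, hθ⟩).toLinearMap)) (fun j u =>
        ⟨DirectSum.lof ℂ _ _ (⟨⟨θ, hθ⟩, j⟩ : Σ θ : Θ, J θ) (indDelta _ u),
          (directSumLift_lof F _ _).trans (hF ⟨⟨θ, hθ⟩, j⟩ u)⟩) ((E ⟨θ, hθ⟩).symm ⟨v, hv⟩)
    have h2 : (E ⟨θ, hθ⟩ ((E ⟨θ, hθ⟩).symm ⟨v, hv⟩)).1 ∈
      (directSumLift F).range.toSubmodule := h1
    rwa [Representation.Equiv.apply_symm_apply] at h2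
  exact ⟨((directSumLift F).ofBijective ⟨hinj, hsurj⟩).symm⟩

end SemidirectSystem

end

theorem mainTheorem2 {H A Y : Type*} {B : Y → Type*} [Group H] [Finite H]
    [AddCommGroup A] [Finite A] [DistribMulAction H A]
    [MulAction H Y] [MulAction.IsPretransitive H Y] [∀ y, AddCommGroup (B y)]
    (S : SemidirectSystem H A Y B) (y₀ : Y)
    (Θ Ξ : Set (AddChar (B y₀) Circle)) (hΘ : S.IsKRepresentatives y₀ Θ)
    (hΞ : S.IsHRepresentatives y₀ Ξ) (hΞΘ : Ξ ⊆ Θ) :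
    -- the criterion, for `L(X)` and as a statement on Gelfand pairs
    (IsMultiplicityFree (permRep (SemiProd H A) S.Space) ↔
      Ξ = Θ ∧ ∀ θ ∈ Θ, IsGelfandPair (S.Hst y₀ θ) (S.Kst y₀ θ)) ∧
    (IsGelfandPair (SemiProd H A) (S.KC y₀) ↔
      Ξ = Θ ∧ ∀ θ ∈ Θ, IsGelfandPair (S.Hst y₀ θ) (S.Kst y₀ θ)) ∧
    -- the meaning of `Ξ = Θ` in terms of orbits
    (Ξ = Θ ↔ ∀ (θ χ : AddChar (B y₀) Circle) (h : H),
      charTranslate h (S.infl y₀ θ) = S.infl y₀ χ → ∃ k, S.baseTranslate y₀ k θ = χ) ∧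
    -- for all decompositions of the spaces `L(H_θ/K_θ)` into irreducible representations
    (∀ {J : Θ → Type*} {U : ∀ θ, J θ → Type*}
      [∀ θ j, AddCommGroup (U θ j)] [∀ θ j, Module ℂ (U θ j)]
      (σ : ∀ (θ : Θ) (j : J θ), Representation ℂ (S.Hst y₀ θ.1) (U θ j))
      (m : ∀ θ : Θ, J θ → ℕ)
      (_ : ∀ θ : Θ, IsIrreducibleDecomposition
        (permRep (S.Hst y₀ θ.1) (S.Hst y₀ θ.1 ⧸ S.Kst y₀ θ.1)) (σ θ) (m θ)),
      -- the decomposition of `L(X)` in the multiplicity-free case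
      (IsMultiplicityFree (permRep (SemiProd H A) S.Space) →
        Nonempty ((permRep (SemiProd H A) S.Space).Equiv (Representation.directSum
          (fun x : (Σ θ : Θ, J θ) => S.wignerRep y₀ x.1.1 (σ x.1 x.2)))) ∧
        (∀ (θ : Θ) (j : J θ), (S.wignerRep y₀ θ.1 (σ θ j)).IsIrreducible) ∧
        ∀ x x' : (Σ θ : Θ, J θ), x ≠ x' →
          IsEmpty ((S.wignerRep y₀ x.1.1 (σ x.1 x.2)).Equiv
            (S.wignerRep y₀ x'.1.1 (σ x'.1 x'.2)))) ∧
      -- the dimension formula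
      (∀ (θ : Θ) (j : J θ),
        (Module.finrank ℂ (indSpace (extTensorInfl (S.Hst y₀ θ.1) (S.infl y₀ θ.1⁻¹)
            (S.charTranslate_infl_inv y₀ θ.1) (σ θ j))) : ℚ) =
          (Nat.card H : ℚ) * (Module.finrank ℂ (U θ j) : ℚ) /
            (Nat.card (S.Hst y₀ θ.1) : ℚ))) := by
  have hfin : Finite S.Space := S.finite_space
  have hfinG : Finite (SemiProd H A) := Finite.of_equiv _ SemidirectProduct.equivProd.symm
  have hGelfand : (∀ θ ∈ Θ, IsGelfandPair (S.Hst y₀ θ) (S.Kst y₀ θ)) ↔ ∀ θ ∈ Θ,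
      Representation.HasCommutingEnd (permRep (S.Hst y₀ θ) (S.Hst y₀ θ ⧸ S.Kst y₀ θ)) :=
    forall₂_congr fun θ _ => Representation.isMultiplicityFree_iff_hasCommutingEnd _
  have hΞΘ' := S.eq_iff_orbitCondition y₀ hΘ hΞ hΞΘ
  have hcrit : IsMultiplicityFree (permRep (SemiProd H A) S.Space) ↔
      Ξ = Θ ∧ ∀ θ ∈ Θ, IsGelfandPair (S.Hst y₀ θ) (S.Kst y₀ θ) := by
    rw [Representation.isMultiplicityFree_iff_hasCommutingEnd, S.hasCommutingEnd_iff y₀ hΘ,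
      hΞΘ', hGelfand]
  have hKC : IsGelfandPair (SemiProd H A) (S.KC y₀) ↔
      IsMultiplicityFree (permRep (SemiProd H A) S.Space) := by
    rw [IsGelfandPair, Representation.isMultiplicityFree_iff_hasCommutingEnd,
      Representation.isMultiplicityFree_iff_hasCommutingEnd,
      Representation.hasCommutingEnd_congr (S.quotientKCEquiv y₀)]
  refine ⟨hcrit, hKC.trans hcrit, hΞΘ', ?_⟩
  intro J U _ _ σ m hdec
  refine ⟨fun hmf => ?_, fun θ j => ?_⟩
  · obtain ⟨hEq, hG⟩ := hcrit.1 hmf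
    have hcond := hΞΘ'.1 hEq
    exact ⟨S.nonempty_equiv_directSum_wignerRep y₀ hΘ hcond (hGelfand.1 hG) σ m hdec,
      fun θ j => isIrreducible_indRep (S.mem_Hst_of_charTranslate_inv y₀)
        ((hdec θ).irreducible j),
      S.isEmpty_wignerRep_equiv y₀ hΘ hcond (fun θ => (hdec θ).irreducible)
        fun θ => (hdec θ).inequivalent⟩
  · have := (hdec θ).finiteDimensional j
    exact S.finrank_wignerRep y₀ θ.1 (σ θ j)
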